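/- Let $\Lambda\subset\mathbb C$ be a lattice with Weierstrass functions $\wp,\zeta$ and invariants $g_2,g_3$, let $\Gamma=\mathbb C/\Lambda$ with the puncture $z=0$, and put $F(u,v)=\zeta(u+v)-\zeta(u-v)-2\zeta(v)$. Let $T$ be the shift $(T\varphi)_n=\varphi_{n+1}$ on sequences $\varphi:\mathbb Z\to\mathbb C$. Let $\gamma:\mathbb Z\to\mathbb C$ satisfy $2\gamma_n\notin\Lambda$ and $\gamma_{n+1}\pm\gamma_n\notin\Lambda$ for all $n$. A symmetric rank-2 Tyurin dynamics over $\gamma$ consists of complex sequences $a^1_n,a^2_n,c_n,v_n$ with $c_n\neq0$, and matrix functions on $\Gamma$ $$X_n(z)=\begin{pmatrix}0&1\\ \chi^1_n(z)&\chi^2_n(z)\end{pmatrix},$$ holomorphic away from $0,\pm\gamma_n$, such that: near $z=0$, $\chi^1_n=-c_{n+1}+O(z)$ and $\chi^2_n=z^{-1}-v_{n+1}+O(z)$; at $\gamma^1_n=\gamma_n$ and $\gamma^2_n=-\gamma_n$ the poles are at most simple, and all rows of the residue are proportional to $\alpha_s(n)=(a^s_n,1)$; and $\alpha_s(n+1)X_n(\gamma^s_{n+1})=0$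 for $s=1,2$. The Baker–Akhiezer function $\psi_n(z)$ is given by $(\psi_{n+1},\psi_{n+2})^t=X_n(\psi_n,\psi_{n+1})^t$. When $a^1_n\ne a^2_n$, put $s_n=-(a^1_n+a^2_n)/(a^1_n-a^2_n)$. (1) For every $s:\mathbb Z\to\mathbb C$ with $s_n^2\ne1$ for all $n$ there is a symmetric rank-2 Tyurin dynamics over $\gamma$ with $a^1_n\neq a^2_n$ whose associated sequence is $s_n$. Thus $\gamma_n$ and $s_n$ are two arbitrary (generic) functions of $n$. (2) For every symmetric rank-2 Tyurin dynamics over $\gamma$ one has $a_n^1\ne a_n^2$, $s_n^2\neq1$ and $$4c_{n+1}=(1-s_n^2)\,F(\gamma_{n+1},\gamma_n)\,F(\gamma_{n-1},\gamma_n),\qquad 2v_{n+1}=s_nF(\gamma_{n+1},\gamma_n)-s_{n+1}F(\gamma_n,\gamma_{n+1}).$$ With $L_2=T+v_n+c_nT^{-1}$, the operator $$L_4=L_2^2-\wp(\gamma_n)-\wp(\gamma_{n-1})$$ has order 4 (it is of the form $\sum_{i=-2}^{2}u_i(n)T^i$ with $u_{2},u_{-2}$ vanishing nowhere), and it is the unique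 scalar difference operator with $L_4\psi=\wp(z)\psi$. (Here and below, such an equation is required at every $z$ outside $\Lambda$ and all $\pm\gamma_m+\Lambda$.) There is an operator $A=\sum_{i=-3}^{3}w_i(n)T^i$ of order 6 ($w_{3},w_{-3}$ vanishing nowhere) with $A\psi=\wp'(z)\psi$, $[L_4,A]=0$ and $A^2=4L_4^3-g_2L_4-g_3$. The pair has rank 2: for every $z\notin\Lambda$ the space of common solutions of $L_4\varphi=\wp(z)\varphi$, $A\varphi=\wp'(z)\varphi$ has dimension 2. -/

import Mathlib

open Filter Topology

noncomputable section

/-- The Weierstrass zeta function of the period lattice,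
`ζ(z) = 1/z + ∑_{l ≠ 0} (1/(z - l) + 1/l + z/l²)`. The summand at `l = 0` is `1/z`,
because division by zero gives zero. -/
def PeriodPair.weierstrassZeta (Λ : PeriodPair) (z : ℂ) : ℂ :=
  ∑' l : Λ.lattice, (1 / (z - l) + 1 / l + z / l ^ 2)

/-- `F(u, v) = ζ(u + v) - ζ(u - v) - 2 ζ(v)`. -/
def ellF (Λ : PeriodPair) (u v : ℂ) : ℂ :=
  Λ.weierstrassZeta (u + v) - Λ.weierstrassZeta (u - v) - 2 * Λ.weierstrassZeta v

/-- The shift operator `T ^ i` on two-sided sequences, `(T ^ i φ)_n = φ_{n + i}`. -/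
def shiftOp (i : ℤ) : Module.End ℂ (ℤ → ℂ) :=
  LinearMap.funLeft ℂ ℂ (fun n => n + i)

/-- Multiplication by a function of the discrete variable. -/
def mulOp (u : ℤ → ℂ) : Module.End ℂ (ℤ → ℂ) where
  toFun φ := fun n => u n * φ n
  map_add' φ ψ := by
    funext n
    simp [mul_add]
  map_smul' r φ := by
    funext n
    simp [mul_left_comm]

/-- The operator `∑_{i = -N}^{M} u_i(n) T ^ i`. -/
def bandOp (N M : ℕ) (u : ℤ → ℤ → ℂ) : Module.End ℂ (ℤ → ℂ) :=
  ∑ i ∈ Finset.Icc (-(N : ℤ)) (M : ℤ), mulOp (u i) * shiftOp i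

/-- `D` is a scalar difference operator. -/
def IsDifferenceOp (D : Module.End ℂ (ℤ → ℂ)) : Prop :=
  ∃ (N M : ℕ) (u : ℤ → ℤ → ℂ), D = bandOp N M u

/-- `D = ∑_{i = -N}^{M} u_i(n) T ^ i` where both extreme coefficients vanish nowhere;
its order is `N + M`. -/
def HasExactBand (N M : ℕ) (D : Module.End ℂ (ℤ → ℂ)) : Prop :=
  ∃ u : ℤ → ℤ → ℂ, (∀ n, u M n ≠ 0) ∧ (∀ n, u (-(N : ℤ)) n ≠ 0) ∧ D = bandOp N M u

/-- `L₂ = T + v_n + c_n T⁻¹`. -/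
def schrodingerOp (v c : ℤ → ℂ) : Module.End ℂ (ℤ → ℂ) :=
  shiftOp 1 + mulOp v + mulOp c * shiftOp (-1)

/-- `L₄ = L₂² - ℘(γ_n) - ℘(γ_{n-1})`. -/
def fourthOrderOp (Λ : PeriodPair) (γ v c : ℤ → ℂ) : Module.End ℂ (ℤ → ℂ) :=
  schrodingerOp v c ^ 2 - mulOp (fun n => Λ.weierstrassP (γ n))
    - mulOp (fun n => Λ.weierstrassP (γ (n - 1)))

/-- `f` has at most a simple pole at `p`, with residue `r`. -/
def HasSimplePoleWithResidue (f : ℂ → ℂ) (p r : ℂ) : Prop :=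
  ∃ g : ℂ → ℂ, AnalyticAt ℂ g p ∧ ∀ᶠ z in 𝓝[≠] p, f z = r / (z - p) + g z

/-- The discrete dynamics of Tyurin parameters of rank 2 on the elliptic curve `ℂ / Λ` with the
puncture `z = 0`. The matrix `X n z` carries `(ψ_n, ψ_{n+1})` to `(ψ_{n+1}, ψ_{n+2})`, where `ψ` is
the Baker-Akhiezer function; the Tyurin parameters at time `n` are the two points `γ s n`
together with the row vectors `α_s(n) = (a s n, 1)`. -/
structure IsTyurinDynamics (Λ : PeriodPair) (γ a : Fin 2 → ℤ → ℂ) (c v : ℤ → ℂ)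
    (X : ℤ → ℂ → Matrix (Fin 2) (Fin 2) ℂ) : Prop where
  /-- `X` is a companion matrix. -/
  first_row : ∀ n z, X n z 0 = ![0, 1]
  /-- The entries are functions on the curve. -/
  periodic : ∀ n z, ∀ l ∈ Λ.lattice, z ∉ Λ.lattice → (∀ s, z - γ s n ∉ Λ.lattice) →
    X n (z + l) = X n z
  /-- The entries are holomorphic away from the puncture and the two Tyurin points. -/
  analytic : ∀ n z, z ∉ Λ.lattice → (∀ s, z - γ s n ∉ Λ.lattice) →
    ∀ i j, AnalyticAt ℂ (fun w => X n w i j) z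
  /-- At the puncture, `χ¹ = -c_{n+1} + O(z)`. -/
  puncture_left : ∀ n, ∃ g : ℂ → ℂ, AnalyticAt ℂ g 0 ∧ g 0 = -c (n + 1) ∧
    ∀ᶠ z in 𝓝[≠] 0, X n z 1 0 = g z
  /-- At the puncture, `χ² = z⁻¹ - v_{n+1} + O(z)`. -/
  puncture_right : ∀ n, ∃ g : ℂ → ℂ, AnalyticAt ℂ g 0 ∧ g 0 = -v (n + 1) ∧
    ∀ᶠ z in 𝓝[≠] 0, X n z 1 1 = z⁻¹ + g z
  /-- At the Tyurin points the poles are at most simple, with every row of the residue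
  proportional to `α_s(n)`. -/
  tyurin_pole : ∀ n s, ∃ ρ : Matrix (Fin 2) (Fin 2) ℂ,
    (∀ m i, HasSimplePoleWithResidue (fun z => X n z m i) (γ s n) (ρ m i)) ∧
    ∀ m i j, (![a s n, 1] : Fin 2 → ℂ) j * ρ m i = (![a s n, 1] : Fin 2 → ℂ) i * ρ m j
  /-- The Tyurin parameters at time `n + 1` are the zeros of `det X n` and the left null vectors
  of `X n` there. -/
  tyurin_step : ∀ n s, Matrix.vecMul ![a s (n + 1), 1] (X n (γ s (n + 1))) = 0
  /-- The leading coefficient `c` of the discrete Schrödinger operator vanishes nowhere. -/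
  c_ne_zero : ∀ n, c n ≠ 0

/-- `D ψ = f ψ` for the Baker-Akhiezer function `ψ` of `X`: at every point `z` of the curve
other than the puncture and the Tyurin points, every sequence that is carried along by `X` is an
eigenvector of `D` with eigenvalue `f z`. -/
def CorrespondsTo (Λ : PeriodPair) (γ : Fin 2 → ℤ → ℂ)
    (X : ℤ → ℂ → Matrix (Fin 2) (Fin 2) ℂ) (f : ℂ → ℂ) (D : Module.End ℂ (ℤ → ℂ)) : Prop :=
  ∀ z, z ∉ Λ.lattice → (∀ s n, z - γ s n ∉ Λ.lattice) → ∀ φ : ℤ → ℂ,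
    (∀ n, ![φ (n + 1), φ (n + 2)] = Matrix.mulVec (X n z) ![φ n, φ (n + 1)]) →
    D φ = f z • φ

/-- The space of common eigenfunctions `L φ = E φ`, `A φ = w φ`. -/
def commonEigenspace (L A : Module.End ℂ (ℤ → ℂ)) (E w : ℂ) : Submodule ℂ (ℤ → ℂ) :=
  Module.End.eigenspace L E ⊓ Module.End.eigenspace A w

/-- The variable `s_n = -(a¹_n + a²_n) / (a¹_n - a²_n)`. -/
def sParam (a : Fin 2 → ℤ → ℂ) (n : ℤ) : ℂ :=
  -(a 0 n + a 1 n) / (a 0 n - a 1 n)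

end

/-! Write `P_n = ℘(γ_n)`, `Q_n = ℘'(γ_n)`, `p = ℘(z)`, `q = ℘'(z)`. The entries of `X_n` are
elliptic with at most simple poles at `0, ±γ_n`, hence combinations of `1`, `1/(℘ - P_n)` and `℘'/(℘
- P_n)` (`eq_of_three_simple_poles`). The puncture fixes all coefficients but two, `E_n` and `B_n`.
The residue conditions read `a¹_n (B_n - Q_n/2) = E_n = a²_n (B_n + Q_n/2)`, and the null vectors at
time `n + 1` give `E_n = c_{n+1} (P_{n+1} - P_n)` and the next `a`. Eliminating, the dynamics is
equivalent to the two relations `v_eq` and `c_eq` of `SpectralData`, with `B_n = -s_n Q_n / 2`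
otherwise free apart from `s_n² ≠ 1` (`IsTyurinDynamics.exists_spectralData`,
`SpectralData.isTyurinDynamics`). The identity `F(u, v) = ℘'(v) / (℘(v) - ℘(u))` turns these
relations into the stated formulas.

In these terms `ψ` solves a second order recurrence whose coefficients are linear in `p` and `q`
(`IsBakerAkhiezer`). That `L₄ψ = pψ` is an elimination using the equation of the curve. Solving the
recurrence for `qφ` and replacing `pφ` by `L₄φ` produces `A` (`sexticOp_eq_iff`).

Uniqueness of `L₄`, commutation and the equation for `A²` share one principle,
`IsLocalOp.eq_zero_of_annihilates`: since `χ²` has a pole at the puncture, the values `ψ_n, ψ_{n+1},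
…` of a suitable solution have pairwise different orders of growth as `z → 0`, so no nonzero
difference operator kills `ψ`.

For the rank, away from the Tyurin points the recurrence is nondegenerate, so its solutions form a
plane. If `p = P_k` it degenerates; there the four-dimensional eigenspace of `L₄` splits under `A² =
q² ≠ 0` into two parts of dimension at most 2. -/

/-! ### Removable singularities and Liouville's theorem for elliptic functions -/

/-- `f` agrees with an analytic function on a punctured neighbourhood of `p`. -/
def IsRemovableAt (f : ℂ → ℂ) (p : ℂ) : Prop :=
  ∃ g : ℂ → ℂ, AnalyticAt ℂ g p ∧ ∀ᶠ z in 𝓝[≠] p, f z = g z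

/-- Near every point, `f` is invariant under translation by lattice vectors. -/
def IsEllipticPeriodic (Λ : PeriodPair) (f : ℂ → ℂ) : Prop :=
  ∀ l ∈ Λ.lattice, ∀ p, ∀ᶠ z in 𝓝[≠] p, f (z + l) = f z

theorem eq_of_eventuallyEq_punctured {f g : ℂ → ℂ} {p : ℂ} (hf : ContinuousAt f p)
    (hg : ContinuousAt g p) (h : ∀ᶠ z in 𝓝[≠] p, f z = g z) : f p = g p :=
  tendsto_nhds_unique_of_eventuallyEq (hf.tendsto.mono_left nhdsWithin_le_nhds)
    (hg.tendsto.mono_left nhdsWithin_le_nhds) h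

theorem eventually_punctured_add {P : ℂ → Prop} {p l : ℂ} (h : ∀ᶠ z in 𝓝[≠] (p + l), P z) :
    ∀ᶠ z in 𝓝[≠] p, P (z + l) := by
  have ht : Tendsto (fun z => z + l) (𝓝[≠] p) (𝓝[≠] (p + l)) := by
    refine tendsto_nhdsWithin_of_tendsto_nhds_of_eventually_within _ ?_ ?_
    · exact ((continuous_add_const l).tendsto p).mono_left nhdsWithin_le_nhds
    · filter_upwards [self_mem_nhdsWithin] with z hz
      simpa using hz
  exact ht.eventually h

theorem eventually_punctured_neg {P : ℂ → Prop} {p : ℂ} (h : ∀ᶠ z in 𝓝[≠] (-p), P z) :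
    ∀ᶠ z in 𝓝[≠] p, P (-z) := by
  have ht : Tendsto (fun z : ℂ => -z) (𝓝[≠] p) (𝓝[≠] (-p)) := by
    refine tendsto_nhdsWithin_of_tendsto_nhds_of_eventually_within _ ?_ ?_
    · exact (continuous_neg.tendsto p).mono_left nhdsWithin_le_nhds
    · filter_upwards [self_mem_nhdsWithin] with z hz
      simpa using hz
  exact ht.eventually h

theorem AnalyticAt.isRemovableAt {f : ℂ → ℂ} {p : ℂ} (h : AnalyticAt ℂ f p) : IsRemovableAt f p :=
  ⟨f, h, Eventually.of_forall fun _ => rfl⟩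

namespace IsRemovableAt

variable {f g : ℂ → ℂ} {p : ℂ}

theorem congr (hf : IsRemovableAt f p) (h : ∀ᶠ z in 𝓝[≠] p, g z = f z) : IsRemovableAt g p := by
  obtain ⟨k, hk, hfk⟩ := hf
  exact ⟨k, hk, by filter_upwards [hfk, h] with z h1 h2; rw [h2, h1]⟩

theorem comp_add {l : ℂ} (hf : IsRemovableAt f (p + l)) : IsRemovableAt (fun z => f (z + l)) p := by
  obtain ⟨k, hk, hfk⟩ := hf
  refine ⟨fun z => k (z + l), ?_, eventually_punctured_add hfk⟩
  exact hk.comp_of_eq (by fun_prop) rfl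

theorem comp_neg (hf : IsRemovableAt f (-p)) : IsRemovableAt (fun z => f (-z)) p := by
  obtain ⟨k, hk, hfk⟩ := hf
  refine ⟨fun z => k (-z), ?_, eventually_punctured_neg hfk⟩
  exact hk.comp_of_eq (by fun_prop) rfl

end IsRemovableAt

theorem IsEllipticPeriodic.isRemovableAt_add {Λ : PeriodPair} {f : ℂ → ℂ}
    (hf : IsEllipticPeriodic Λ f) {p l : ℂ} (hl : l ∈ Λ.lattice) (h : IsRemovableAt f p) :
    IsRemovableAt f (p + l) := by
  have h' : IsRemovableAt f ((p + l) + -l) := by simpa using h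
  refine h'.comp_add.congr ?_
  filter_upwards [hf (-l) (neg_mem hl) (p + l)] with z hz
  rw [hz]

namespace PeriodPair

variable (Λ : PeriodPair)

theorem eventually_sub_notMem_lattice (p t : ℂ) : ∀ᶠ z in 𝓝[≠] p, z - t ∉ Λ.lattice := by
  have h := Λ.compl_lattice_sdiff_singleton_mem_nhds (p - t)
  have h2 : ∀ᶠ z in 𝓝 p, z - t ∈ ((Λ.lattice : Set ℂ) \ {p - t})ᶜ :=
    (by fun_prop : ContinuousAt (fun z : ℂ => z - t) p).eventually h
  filter_upwards [nhdsWithin_le_nhds h2, self_mem_nhdsWithin] with z hz hz' hmem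
  apply hz
  refine ⟨hmem, ?_⟩
  simpa using hz'

theorem eventually_notMem_lattice (p : ℂ) : ∀ᶠ z in 𝓝[≠] p, z ∉ Λ.lattice := by
  simpa using Λ.eventually_sub_notMem_lattice p 0

end PeriodPair

/-- Removable singularities of a function can be removed simultaneously. -/
theorem exists_analyticAt_of_isRemovableAt {f : ℂ → ℂ} {U : Set ℂ} (hU : IsOpen U)
    (hrem : ∀ p ∈ U, IsRemovableAt f p) :
    ∃ F : ℂ → ℂ, ∀ p ∈ U, AnalyticAt ℂ F p ∧ ∀ᶠ z in 𝓝[≠] p, f z = F z := by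
  have hex : ∀ p, ∃ g : ℂ → ℂ, p ∈ U → AnalyticAt ℂ g p ∧ ∀ᶠ z in 𝓝[≠] p, f z = g z := by
    intro p
    by_cases hp : p ∈ U
    · obtain ⟨g, hg⟩ := hrem p hp
      exact ⟨g, fun _ => hg⟩
    · exact ⟨0, fun h => absurd h hp⟩
  choose g hg using hex
  -- The local extensions glue along the diagonal `fun z => g z z`: for `z` near `p`, both `g z` and
  -- `g p` are continuous at `z` and agree with `f` on a punctured neighbourhood of `z`.
  have key : ∀ p ∈ U, ∀ᶠ z in 𝓝 p, g z z = g p z := by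
    intro p hp
    have h1 : ∀ᶠ z in 𝓝[≠] p, g z z = g p z := by
      filter_upwards [eventually_eventually_nhdsWithin.2 (hg p hp).2, self_mem_nhdsWithin,
        nhdsWithin_le_nhds (hg p hp).1.eventually_analyticAt,
        nhdsWithin_le_nhds (hU.mem_nhds hp)] with z hz hzp hz' hzU
      refine eq_of_eventuallyEq_punctured (hg z hzU).1.continuousAt hz'.continuousAt ?_
      rw [isOpen_compl_singleton.nhdsWithin_eq hzp] at hz
      filter_upwards [nhdsWithin_le_nhds hz, (hg z hzU).2] with y h4 h5
      rw [← h5, h4]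
    rw [← nhdsNE_sup_pure p]
    exact eventually_sup.2 ⟨h1, by simp⟩
  refine ⟨fun z => g z z, fun p hp => ⟨?_, ?_⟩⟩
  · exact (hg p hp).1.congr ((key p hp).mono fun z hz => hz.symm)
  · filter_upwards [(hg p hp).2, nhdsWithin_le_nhds (key p hp)] with z h1 h2
    rw [h1, h2]

/-- Periodicity passes to the function with the singularities removed. -/
theorem IsEllipticPeriodic.apply_add {Λ : PeriodPair} {f F : ℂ → ℂ} (hf : IsEllipticPeriodic Λ f)
    {z l : ℂ} (hl : l ∈ Λ.lattice) (h1 : AnalyticAt ℂ F z) (h2 : AnalyticAt ℂ F (z + l))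
    (h3 : ∀ᶠ y in 𝓝[≠] z, f y = F y) (h4 : ∀ᶠ y in 𝓝[≠] (z + l), f y = F y) :
    F (z + l) = F z := by
  refine eq_of_eventuallyEq_punctured (f := fun y => F (y + l)) ?_ h1.continuousAt ?_
  · exact ContinuousAt.comp' (f := fun y => y + l) h2.continuousAt (by fun_prop)
  · filter_upwards [eventually_punctured_add h4, h3, hf l hl z] with y h5 h6 h7
    rw [← h5, h7, h6]

/-- An elliptic function with only removable singularities is constant. -/
theorem IsEllipticPeriodic.liouville {Λ : PeriodPair} {f : ℂ → ℂ} (hper : IsEllipticPeriodic Λ f)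
    (hrem : ∀ p, IsRemovableAt f p) :
    ∃ c : ℂ, (∀ p, ∀ᶠ z in 𝓝[≠] p, f z = c) ∧ ∀ p, ContinuousAt f p → f p = c := by
  obtain ⟨F, hF⟩ := exists_analyticAt_of_isRemovableAt isOpen_univ fun p _ => hrem p
  simp only [Set.mem_univ, true_imp_iff] at hF
  have hdiff : Differentiable ℂ F := fun p => (hF p).1.differentiableAt
  have hperF : ∀ z w, w ∈ Λ.lattice → F (z + w) = F z := fun z w hw =>
    hper.apply_add hw (hF z).1 (hF _).1 (hF z).2 (hF _).2
  have hc : ∀ p, ∀ᶠ z in 𝓝[≠] p, f z = F 0 := by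
    intro p
    filter_upwards [(hF p).2] with z h1
    rw [h1]
    exact hdiff.apply_eq_apply_of_bounded (IsZLattice.isCompact_range_of_periodic Λ.lattice _
      hdiff.continuous hperF).isBounded z 0
  exact ⟨F 0, hc, fun p hp => eq_of_eventuallyEq_punctured hp continuousAt_const (hc p)⟩

/-! ### Simple poles -/

theorem AnalyticAt.exists_eq_sub_mul {f : ℂ → ℂ} {p : ℂ} (hf : AnalyticAt ℂ f p) (h0 : f p = 0) :
    ∃ k : ℂ → ℂ, AnalyticAt ℂ k p ∧ k p = deriv f p ∧ ∀ z, f z = (z - p) * k z := by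
  obtain ⟨s, hs⟩ := hf
  refine ⟨dslope f p, ⟨_, hs.has_fpower_series_dslope_fslope⟩, dslope_same f p, fun z => ?_⟩
  have := sub_smul_dslope f p z
  rw [smul_eq_mul, h0, sub_zero] at this
  exact this.symm

namespace HasSimplePoleWithResidue

variable {f g : ℂ → ℂ} {p r : ℂ}

theorem of_analyticAt (hf : AnalyticAt ℂ f p) : HasSimplePoleWithResidue f p 0 :=
  ⟨f, hf, Eventually.of_forall fun z => by simp⟩

theorem isRemovableAt (hf : HasSimplePoleWithResidue f p 0) : IsRemovableAt f p := by
  obtain ⟨g, hg, h⟩ := hf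
  exact ⟨g, hg, by simpa using h⟩

theorem add {s : ℂ} (hf : HasSimplePoleWithResidue f p r) (hg : HasSimplePoleWithResidue g p s) :
    HasSimplePoleWithResidue (fun z => f z + g z) p (r + s) := by
  obtain ⟨k, hk, h⟩ := hf
  obtain ⟨m, hm, h'⟩ := hg
  refine ⟨fun z => k z + m z, hk.add hm, ?_⟩
  filter_upwards [h, h'] with z h1 h2
  rw [h1, h2]; ring

theorem const_mul (a : ℂ) (hf : HasSimplePoleWithResidue f p r) :
    HasSimplePoleWithResidue (fun z => a * f z) p (a * r) := by
  obtain ⟨k, hk, h⟩ := hf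
  refine ⟨fun z => a * k z, analyticAt_const.mul hk, ?_⟩
  filter_upwards [h] with z h1
  rw [h1]; ring

theorem congr (hf : HasSimplePoleWithResidue f p r) (h : ∀ᶠ z in 𝓝[≠] p, g z = f z) :
    HasSimplePoleWithResidue g p r := by
  obtain ⟨k, hk, h'⟩ := hf
  exact ⟨k, hk, by filter_upwards [h, h'] with z h1 h2; rw [h1, h2]⟩

theorem comp_add {l : ℂ} (hf : HasSimplePoleWithResidue f (p + l) r) :
    HasSimplePoleWithResidue (fun z => f (z + l)) p r := by
  obtain ⟨k, hk, h⟩ := hf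
  refine ⟨fun z => k (z + l), hk.comp_of_eq (by fun_prop) rfl, ?_⟩
  filter_upwards [eventually_punctured_add h] with z hz
  rw [hz, add_sub_add_right_eq_sub]

theorem comp_neg (hf : HasSimplePoleWithResidue f (-p) r) :
    HasSimplePoleWithResidue (fun z => f (-z)) p (-r) := by
  obtain ⟨k, hk, h⟩ := hf
  refine ⟨fun z => k (-z), hk.comp_of_eq (by fun_prop) rfl, ?_⟩
  filter_upwards [eventually_punctured_neg h] with z hz
  rw [hz, show -z - -p = -(z - p) by ring, div_neg, neg_div]

/-- A simple pole is cancelled by a zero. -/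
theorem exists_mul_eq (hf : HasSimplePoleWithResidue f p r) (hg : AnalyticAt ℂ g p)
    (h0 : g p = 0) : ∃ m : ℂ → ℂ, AnalyticAt ℂ m p ∧ m p = r * deriv g p ∧
      ∀ᶠ z in 𝓝[≠] p, f z * g z = m z := by
  obtain ⟨k, hk, h⟩ := hf
  obtain ⟨j, hj, hjp, hgj⟩ := hg.exists_eq_sub_mul h0
  refine ⟨fun z => (r + (z - p) * k z) * j z, by fun_prop, by simp [hjp], ?_⟩
  filter_upwards [h, self_mem_nhdsWithin] with z hz hzp
  have : z - p ≠ 0 := sub_ne_zero.2 hzp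
  rw [hz, hgj]
  field

theorem tendsto_sub_mul (hf : HasSimplePoleWithResidue f p r) :
    Tendsto (fun z => (z - p) * f z) (𝓝[≠] p) (𝓝 r) := by
  obtain ⟨k, hk, h⟩ := hf
  have h1 : ContinuousAt (fun z => r + (z - p) * k z) p := by
    have := hk.continuousAt
    fun_prop
  have h2 : Tendsto (fun z => r + (z - p) * k z) (𝓝[≠] p) (𝓝 r) := by
    simpa using h1.tendsto.mono_left nhdsWithin_le_nhds
  refine h2.congr' ?_
  filter_upwards [h, self_mem_nhdsWithin] with z hz hzp
  have : z - p ≠ 0 := sub_ne_zero.2 hzp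
  rw [hz]
  field

theorem eventually_ne_zero (hf : HasSimplePoleWithResidue f p r) (hr : r ≠ 0) :
    ∀ᶠ z in 𝓝[≠] p, f z ≠ 0 := by
  filter_upwards [hf.tendsto_sub_mul.eventually_ne hr] with z hz h
  simp [h] at hz

end HasSimplePoleWithResidue

namespace PeriodPair

variable (Λ : PeriodPair)

/-! ### The Weierstrass zeta function -/

/-- The three fractions combine to `s² / (l² (s - l))`, so the zeta series is dominated by `∑
‖l‖⁻³`, which converges over a lattice of rank 2. -/
theorem weierstrassZeta_bound (r : ℝ) (hr : 0 < r) (s : ℂ) (hs : ‖s‖ < r) (l : ℂ)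
    (h : 2 * r ≤ ‖l‖) : ‖1 / (s - l) + 1 / l + s / l ^ 2‖ ≤ 2 * r ^ 2 * ‖l‖ ^ (-3 : ℝ) := by
  have hsl : s ≠ l := by rintro rfl; linarith
  have hl : 0 < ‖l‖ := by linarith
  have hl0 : l ≠ 0 := norm_pos_iff.1 hl
  have hsub : s - l ≠ 0 := sub_ne_zero.2 hsl
  have hge : ‖l‖ / 2 ≤ ‖s - l‖ := by
    rw [norm_sub_rev]
    exact .trans (by linarith) (norm_sub_norm_le l s)
  calc
    _ = ‖s ^ 2 / (l ^ 2 * (s - l))‖ := by congr 1; field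
    _ = ‖s‖ ^ 2 / (‖l‖ ^ 2 * ‖s - l‖) := by simp
    _ ≤ r ^ 2 / (‖l‖ ^ 2 * (‖l‖ / 2)) := by gcongr
    _ = 2 * r ^ 2 / ‖l‖ ^ 3 := by field
    _ = _ := by norm_cast

/-- The Weierstrass zeta function without its pole at the origin. -/
noncomputable def weierstrassZetaExcept (z : ℂ) : ℂ :=
  ∑' l : Λ.lattice, if l = 0 then 0 else (1 / (z - l) + 1 / l + z / l ^ 2)

theorem hasSumLocallyUniformly_weierstrassZeta :
    HasSumLocallyUniformly (fun (l : Λ.lattice) (z : ℂ) => 1 / (z - l) + 1 / l + z / l ^ 2)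
      Λ.weierstrassZeta := by
  refine Λ.hasSumLocallyUniformly_aux (u := (2 * · ^ 2 * ‖·‖ ^ (-3 : ℝ))) _
    (fun _ _ ↦ (ZLattice.summable_norm_rpow _ _ (by simp; norm_num)).mul_left _) fun r hr ↦
    Filter.eventually_atTop.mpr ⟨2 * r, ?_⟩
  rintro _ h s hs l rfl
  exact weierstrassZeta_bound r hr s hs l h

theorem hasSumLocallyUniformly_weierstrassZetaExcept :
    HasSumLocallyUniformly
      (fun (l : Λ.lattice) (z : ℂ) => if l = 0 then 0 else (1 / (z - l) + 1 / l + z / l ^ 2))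
      Λ.weierstrassZetaExcept := by
  refine Λ.hasSumLocallyUniformly_aux (u := (2 * · ^ 2 * ‖·‖ ^ (-3 : ℝ))) _
    (fun _ _ ↦ (ZLattice.summable_norm_rpow _ _ (by simp; norm_num)).mul_left _) fun r hr ↦
    Filter.eventually_atTop.mpr ⟨2 * r, ?_⟩
  rintro _ h s hs l rfl
  split_ifs
  · simpa using! show 0 ≤ 2 * r ^ 2 * (‖↑l‖ ^ 3)⁻¹ by positivity
  · exact weierstrassZeta_bound r hr s hs l h

theorem weierstrassZeta_eq (z : ℂ) : Λ.weierstrassZeta z = 1 / z + Λ.weierstrassZetaExcept z := by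
  have h1 := (Λ.hasSumLocallyUniformly_weierstrassZetaExcept).hasSum (x := z)
  have h2 : HasSum (fun l : Λ.lattice => if l = 0 then 1 / z else 0) (1 / z) := by
    simpa using hasSum_ite_eq (0 : Λ.lattice) (1 / z)
  refine HasSum.tsum_eq ?_
  convert! h2.add h1 using 2 with l
  split_ifs with hl
  · simp [hl]
  · simp

theorem hasDerivAt_weierstrassZeta {z : ℂ} (hz : z ∉ Λ.lattice) :
    HasDerivAt Λ.weierstrassZeta (-Λ.weierstrassP z) z := by
  have hopen := Λ.isClosed_lattice.isOpen_compl
  have hterm : ∀ (l : Λ.lattice), ∀ w ∈ (Λ.lattice : Set ℂ)ᶜ,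
      HasDerivAt (fun w : ℂ => 1 / (w - l) + 1 / l + w / l ^ 2)
        (-(1 / (w - l) ^ 2 - 1 / l ^ 2)) w := by
    intro l w hw
    have hne : w - l ≠ 0 := by
      rw [sub_ne_zero]; rintro rfl; exact hw l.2
    have h1 := ((hasDerivAt_id w).sub_const (l : ℂ)).inv hne
    have h2 := (h1.add_const (1 / (l : ℂ))).add ((hasDerivAt_id w).div_const ((l : ℂ) ^ 2))
    convert! h2 using 1
    · ext x; simp
    · simp; ring
  have hu := (Λ.hasSumLocallyUniformly_weierstrassZeta).hasSumLocallyUniformlyOn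
    (s := (Λ.lattice : Set ℂ)ᶜ)
  have hd : DifferentiableOn ℂ Λ.weierstrassZeta (Λ.lattice : Set ℂ)ᶜ := by
    refine hu.differentiableOn (.of_forall fun s => .fun_sum fun l _ => ?_) hopen
    exact fun w hw => (hterm l w hw).differentiableAt.differentiableWithinAt
  have hu2 : TendstoLocallyUniformlyOn _ _ _ _ :=
    hasSumLocallyUniformlyOn_iff_tendstoLocallyUniformlyOn.1 hu
  have ht := (hu2.deriv (.of_forall fun s => .fun_sum fun l _ =>
    fun w hw => (hterm l w hw).differentiableAt.differentiableWithinAt) hopen).tendsto_at hz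
  have hP : Tendsto (fun s : Finset Λ.lattice => ∑ l ∈ s, -(1 / (z - l) ^ 2 - 1 / (l : ℂ) ^ 2)) atTop
      (𝓝 (-Λ.weierstrassP z)) := (Λ.hasSum_weierstrassP z).neg
  have heq := tendsto_nhds_unique (ht.congr fun s => ?_) hP
  · rw [← heq]
    exact (hd.differentiableAt (hopen.mem_nhds hz)).hasDerivAt
  · simp only [Function.comp_apply]
    rw [deriv_fun_sum fun l _ => (hterm l z hz).differentiableAt]
    exact Finset.sum_congr rfl fun l _ => (hterm l z hz).deriv

theorem analyticAt_weierstrassZeta {z : ℂ} (hz : z ∉ Λ.lattice) :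
    AnalyticAt ℂ Λ.weierstrassZeta z := by
  refine DifferentiableOn.analyticAt (s := (Λ.lattice : Set ℂ)ᶜ) (fun w hw => ?_)
    (Λ.isClosed_lattice.isOpen_compl.mem_nhds hz)
  exact (Λ.hasDerivAt_weierstrassZeta hw).differentiableAt.differentiableWithinAt

theorem analyticAt_weierstrassZetaExcept_zero : AnalyticAt ℂ Λ.weierstrassZetaExcept 0 := by
  refine DifferentiableOn.analyticAt (s := ((Λ.lattice : Set ℂ) \ {0})ᶜ) ?_
    (Λ.compl_lattice_sdiff_singleton_mem_nhds 0)
  refine (Λ.hasSumLocallyUniformly_weierstrassZetaExcept).hasSumLocallyUniformlyOn.differentiableOn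
    (.of_forall fun s ↦ .fun_sum fun l hl ↦ ?_) Λ.isOpen_compl_lattice_sdiff
  split_ifs with h
  · simp
  · refine .add (.add (.div (by fun_prop) (by fun_prop) fun w hw => ?_) (by fun_prop))
      (by fun_prop)
    rw [sub_ne_zero]
    rintro rfl
    exact hw ⟨l.2, by simpa using h⟩

theorem weierstrassZeta_neg (z : ℂ) : Λ.weierstrassZeta (-z) = -Λ.weierstrassZeta z := by
  rw [weierstrassZeta, weierstrassZeta, ← (Equiv.neg Λ.lattice).tsum_eq, ← tsum_neg]
  congr with l
  simp only [Equiv.neg_apply, NegMemClass.coe_neg, sub_neg_eq_add, even_two, Even.neg_pow]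
  rw [show -z + l = -(z - (l : ℂ)) by ring, div_neg, div_neg]
  ring

theorem isPreconnected_compl_lattice : IsPreconnected (Λ.lattice : Set ℂ)ᶜ := by
  refine (Set.Countable.isConnected_compl_of_one_lt_rank (by simp) ?_).2
  have : Countable Λ.lattice := Λ.latticeEquivProd.toEquiv.countable_iff.2 inferInstance
  exact Set.countable_coe_iff.1 this

theorem add_mem_lattice_iff {l : ℂ} (hl : l ∈ Λ.lattice) {z : ℂ} :
    z + l ∈ Λ.lattice ↔ z ∈ Λ.lattice :=
  Λ.lattice.toAddSubgroup.add_mem_cancel_right hl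

/-- The derivative of the difference is `℘(z) - ℘(z + l) = 0` on a connected set. These
quasi-periods cancel in `ζ(u + v) - ζ(u - v)`, which makes `F` elliptic in `u`. -/
theorem exists_weierstrassZeta_add {l : ℂ} (hl : l ∈ Λ.lattice) :
    ∃ η : ℂ, ∀ z ∉ Λ.lattice, Λ.weierstrassZeta (z + l) = Λ.weierstrassZeta z + η := by
  have hd : ∀ z ∈ (Λ.lattice : Set ℂ)ᶜ,
      HasDerivAt (fun z => Λ.weierstrassZeta (z + l) - Λ.weierstrassZeta z) 0 z := by
    intro z hz
    have h1 := Λ.hasDerivAt_weierstrassZeta (z := z + l) ((Λ.add_mem_lattice_iff hl).not.2 hz)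
    have h2 := (h1.comp_add_const z l).sub (Λ.hasDerivAt_weierstrassZeta hz)
    convert! h2 using 1
    have := Λ.weierstrassP_add_coe z ⟨l, hl⟩
    simp only at this
    rw [this]; ring
  obtain ⟨η, hη⟩ := Λ.isClosed_lattice.isOpen_compl.exists_is_const_of_deriv_eq_zero
    Λ.isPreconnected_compl_lattice
    (fun z hz => (hd z hz).differentiableAt.differentiableWithinAt) fun z hz => (hd z hz).deriv
  exact ⟨η, fun z hz => by rw [← hη z hz]; ring⟩

end PeriodPair

/-! ### Elliptic functions with one simple pole, and the closed form of `F`. -/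

namespace PeriodPair

variable (Λ : PeriodPair)

theorem notMem_lattice_of_two_mul {v : ℂ} (hv : 2 * v ∉ Λ.lattice) : v ∉ Λ.lattice := by
  intro h
  exact hv (by simpa [two_mul] using add_mem h h)

theorem add_notMem_lattice {l : ℂ} (hl : l ∈ Λ.lattice) {z : ℂ} (hz : z ∉ Λ.lattice) :
    z + l ∉ Λ.lattice := (Λ.add_mem_lattice_iff hl).not.2 hz

theorem neg_notMem_lattice {z : ℂ} (hz : z ∉ Λ.lattice) : -z ∉ Λ.lattice := by
  simpa using hz

/-- An elliptic function cannot have a single simple pole. -/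
theorem residue_eq_zero_of_single_pole {f : ℂ → ℂ} {ρ : ℂ} (hper : IsEllipticPeriodic Λ f)
    (hrem : ∀ p ∉ Λ.lattice, IsRemovableAt f p) (hpole : HasSimplePoleWithResidue f 0 ρ) :
    ρ = 0 := by
  by_contra hρ
  obtain ⟨F, hF⟩ := exists_analyticAt_of_isRemovableAt Λ.isClosed_lattice.isOpen_compl hrem
  have hFper : ∀ z ∉ Λ.lattice, ∀ l ∈ Λ.lattice, F (z + l) = F z := by
    intro z hz l hl
    have hz' := Λ.add_notMem_lattice hl hz
    exact hper.apply_add hl (hF z hz).1 (hF _ hz').1 (hF z hz).2 (hF _ hz').2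
  have hFpole : HasSimplePoleWithResidue F 0 ρ := by
    refine hpole.congr ?_
    have h1 : ∀ᶠ z in 𝓝[≠] (0 : ℂ), z ∉ Λ.lattice := Λ.eventually_notMem_lattice 0
    obtain ⟨k, hk, hfk⟩ := hpole
    filter_upwards [h1, self_mem_nhdsWithin, eventually_eventually_nhdsWithin.2 hfk,
      nhdsWithin_le_nhds hk.eventually_analyticAt, hfk] with z hz hz0 hz1 hz2 hz3
    rw [isOpen_compl_singleton.nhdsWithin_eq hz0] at hz1
    rw [hz3]
    have hz0' : z - 0 ≠ 0 := by simpa using hz0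
    refine eq_of_eventuallyEq_punctured (g := fun z => ρ / (z - 0) + k z)
      (hF z hz).1.continuousAt ?_ ?_
    · have := hz2.continuousAt
      fun_prop (disch := assumption)
    · filter_upwards [(hF z hz).2, nhdsWithin_le_nhds hz1] with y h2 h3
      rw [← h2, h3]
  -- Normalise `F` to an odd function.
  have hS : ∃ s, ∀ z ∉ Λ.lattice, F z + F (-z) = s := by
    have hper2 : IsEllipticPeriodic Λ fun z => F z + F (-z) := by
      intro l hl p
      filter_upwards [Λ.eventually_notMem_lattice p] with z hz
      rw [hFper z hz l hl, neg_add, hFper (-z) (Λ.neg_notMem_lattice hz) (-l) (neg_mem hl)]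
    have han : ∀ p ∉ Λ.lattice, AnalyticAt ℂ (fun z => F z + F (-z)) p := by
      intro p hp
      refine (hF p hp).1.add ?_
      exact (hF (-p) (Λ.neg_notMem_lattice hp)).1.comp_of_eq (by fun_prop) rfl
    obtain ⟨s, -, hs⟩ := hper2.liouville fun p => by
      by_cases hp : p ∈ Λ.lattice
      · have := hper2.isRemovableAt_add (p := 0) hp ?_
        · simpa using this
        · refine HasSimplePoleWithResidue.isRemovableAt ?_
          have h1 := hFpole.add (HasSimplePoleWithResidue.comp_neg (p := 0) (by simpa using hFpole))
          rwa [add_neg_cancel] at h1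
      · exact (han p hp).isRemovableAt
    exact ⟨s, fun z hz => hs z (han z hz).continuousAt⟩
  obtain ⟨s, hs⟩ := hS
  obtain ⟨K, hK⟩ : ∃ K : ℂ → ℂ, K = fun z => F z + -(s / 2) := ⟨_, rfl⟩
  have hKan : ∀ p ∉ Λ.lattice, AnalyticAt ℂ K p := by
    intro p hp
    rw [hK]
    exact (hF p hp).1.add analyticAt_const
  have hKper : ∀ z ∉ Λ.lattice, ∀ l ∈ Λ.lattice, K (z + l) = K z := by
    intro z hz l hl
    rw [hK]
    simp only [hFper z hz l hl]
  have hKpole : HasSimplePoleWithResidue K 0 ρ := by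
    rw [hK]
    simpa using hFpole.add (HasSimplePoleWithResidue.of_analyticAt analyticAt_const)
  have hKhalf : ∀ v ∉ Λ.lattice, 2 * v ∈ Λ.lattice → K v = 0 := by
    intro v hv h2
    have h1 := hKper (-v) (Λ.neg_notMem_lattice hv) (2 * v) h2
    have h3 := hs v hv
    rw [show -v + 2 * v = v by ring] at h1
    simp only [hK] at h1 ⊢
    linear_combination h1 / 2 + h3 / 2
  -- Two distinct nonzero half periods, at which the odd function `K` must vanish.
  obtain ⟨v, w, hv, hw, hwv, hv2, hw2⟩ : ∃ v w : ℂ, v ∉ Λ.lattice ∧ w ∉ Λ.lattice ∧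
      w - v ∉ Λ.lattice ∧ 2 * v ∈ Λ.lattice ∧ 2 * w ∈ Λ.lattice := by
    refine ⟨Λ.ω₁ / 2, Λ.ω₂ / 2, Λ.ω₁_div_two_notMem_lattice, Λ.ω₂_div_two_notMem_lattice, ?_, ?_, ?_⟩
    · have := (Λ.mul_ω₁_add_mul_ω₂_mem_lattice (α := -1 / 2) (β := 1 / 2)).not.mpr (by norm_num)
      convert! this using 2
      push_cast; ring
    · simpa [mul_div_cancel₀] using Λ.ω₁_mem_lattice
    · simpa [mul_div_cancel₀] using Λ.ω₂_mem_lattice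
  -- The product is entire: the pole of `K z` at `0` meets the zero `K (-v) = 0`, and the pole of `K
  -- (z - v)` at `v` meets `K v = 0`. It is therefore constant, and its value at `w` is zero. Since
  -- `K` does not vanish near its pole, it vanishes near `-v`, hence everywhere by the identity
  -- theorem.
  have hM : ∀ z ∉ Λ.lattice, z - v ∉ Λ.lattice → K z * K (z - v) = 0 := by
    have hper2 : IsEllipticPeriodic Λ fun z => K z * K (z - v) := by
      intro l hl p
      filter_upwards [Λ.eventually_notMem_lattice p, Λ.eventually_sub_notMem_lattice p v]
        with z hz hz'
      rw [hKper z hz l hl, add_sub_right_comm, hKper (z - v) hz' l hl]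
    have hanv : ∀ p, p - v ∉ Λ.lattice → AnalyticAt ℂ (fun z => K (z - v)) p := fun p hp =>
      (hKan (p - v) hp).comp_of_eq (by fun_prop) rfl
    have han : ∀ p ∉ Λ.lattice, p - v ∉ Λ.lattice →
        AnalyticAt ℂ (fun z => K z * K (z - v)) p :=
      fun p hp hpv => (hKan p hp).mul (hanv p hpv)
    obtain ⟨c, -, hc⟩ := hper2.liouville fun p => by
      by_cases hp : p ∈ Λ.lattice
      · have := hper2.isRemovableAt_add (p := 0) hp ?_
        · simpa using this
        · obtain ⟨m, hm, -, h⟩ := hKpole.exists_mul_eq (hanv 0 (by simpa using hv))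
            (by simpa using hKhalf (-v) (Λ.neg_notMem_lattice hv) (by simpa using hv2))
          exact ⟨m, hm, h⟩
      · by_cases hpv : p - v ∈ Λ.lattice
        · have := hper2.isRemovableAt_add (p := v) hpv ?_
          · simpa using this
          · have h1 : HasSimplePoleWithResidue (fun z => K (z - v)) v ρ := by
              simpa [sub_eq_add_neg] using
                HasSimplePoleWithResidue.comp_add (p := v) (l := -v) (by simpa using hKpole)
            obtain ⟨m, hm, -, h⟩ := h1.exists_mul_eq (hKan v hv) (hKhalf v hv hv2)
            exact ⟨m, hm, by simpa only [mul_comm] using h⟩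
        · exact (han p hp hpv).isRemovableAt
    intro z hz hzv
    rw [hc z (han z hz hzv).continuousAt, ← hc w (han w hw hwv).continuousAt, hKhalf w hw hw2,
      zero_mul]
  have hKne := hKpole.eventually_ne_zero hρ
  have hzero : ∀ᶠ z in 𝓝[≠] (-v), K z = 0 := by
    have h1 : ∀ᶠ z in 𝓝[≠] (-v + v), K (z + -v) = 0 := by
      rw [neg_add_cancel]
      filter_upwards [hKne, Λ.eventually_notMem_lattice 0, Λ.eventually_sub_notMem_lattice 0 v]
        with z h2 h3 h4
      exact (mul_eq_zero.1 (hM z h3 h4)).resolve_left h2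
    simpa using eventually_punctured_add h1
  have hall : Set.EqOn K 0 (Λ.lattice : Set ℂ)ᶜ :=
    AnalyticOnNhd.eqOn_zero_of_preconnected_of_frequently_eq_zero (fun p hp => hKan p hp)
      Λ.isPreconnected_compl_lattice (Λ.neg_notMem_lattice hv) hzero.frequently
  obtain ⟨z, hz, hz'⟩ := (hKne.and (Λ.eventually_notMem_lattice 0)).exists
  exact hz (hall hz')

theorem weierstrassP_eq (z : ℂ) : Λ.weierstrassP z = Λ.weierstrassPExcept 0 z + 1 / z ^ 2 := by
  simpa using (Λ.weierstrassPExcept_add 0 z).symm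

theorem derivWeierstrassP_eq (z : ℂ) :
    Λ.derivWeierstrassP z = Λ.derivWeierstrassPExcept 0 z - 2 / z ^ 3 := by
  simpa using (Λ.derivWeierstrassPExcept_sub 0 z).symm

theorem weierstrassP_not_eventually_const {p c : ℂ} (hp : p ∉ Λ.lattice) :
    ¬ ∀ᶠ z in 𝓝[≠] p, Λ.weierstrassP z = c := by
  intro h
  have hall : Set.EqOn (fun z => Λ.weierstrassP z - c) 0 (Λ.lattice : Set ℂ)ᶜ :=
    AnalyticOnNhd.eqOn_zero_of_preconnected_of_frequently_eq_zero
      (fun p hp => (Λ.analyticOnNhd_weierstrassP p hp).sub analyticAt_const)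
      Λ.isPreconnected_compl_lattice hp (h.mono fun z hz => by simp [hz]).frequently
  have h1 : ContinuousAt (fun z => z ^ 2 * (c - Λ.weierstrassPExcept 0 z)) 0 := by
    have := (Λ.analyticAt_weierstrassPExcept 0).continuousAt
    fun_prop
  have h2 := eq_of_eventuallyEq_punctured h1 (continuousAt_const (y := (1 : ℂ))) ?_
  · simp at h2
  · filter_upwards [Λ.eventually_notMem_lattice 0, self_mem_nhdsWithin] with z hz hz0
    have h3 := hall hz
    have hz0' : z ≠ 0 := hz0
    simp only [Pi.zero_apply, Λ.weierstrassP_eq] at h3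
    have h4 : c - Λ.weierstrassPExcept 0 z = 1 / z ^ 2 := by linear_combination -h3
    rw [h4]
    field

theorem hasSimplePole_weierstrassZeta : HasSimplePoleWithResidue Λ.weierstrassZeta 0 1 :=
  ⟨_, Λ.analyticAt_weierstrassZetaExcept_zero,
    Eventually.of_forall fun z => by rw [Λ.weierstrassZeta_eq, sub_zero]⟩

/-- As a function of `u` the product has no poles. The simple poles of `F` at `±v` meet zeros of
`℘(v) - ℘(u)`, and the double pole of `℘` at `0` meets a double zero of `F`, which is even in `u`
and vanishes at `0`. By Liouville the product is constant; its value at `u = v` is the residue `-1`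
times `-℘'(v)`. -/
theorem ellF_mul {v : ℂ} (hv : 2 * v ∉ Λ.lattice) :
    (HasSimplePoleWithResidue (fun u => ellF Λ u v) v (-1)) ∧
    ∀ u, u ∉ Λ.lattice → u + v ∉ Λ.lattice → u - v ∉ Λ.lattice →
      ellF Λ u v * (Λ.weierstrassP v - Λ.weierstrassP u) = Λ.derivWeierstrassP v := by
  have hv1 := Λ.notMem_lattice_of_two_mul hv
  have hsubper : ∀ l ∈ Λ.lattice, ∀ u, u + v ∉ Λ.lattice → u - v ∉ Λ.lattice →
      ellF Λ (u + l) v = ellF Λ u v := by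
    intro l hl u h1 h2
    obtain ⟨η, hη⟩ := Λ.exists_weierstrassZeta_add hl
    rw [ellF, add_right_comm, hη _ h1, show u + l - v = u - v + l by ring, hη _ h2, ellF]
    ring
  have heven : ∀ u, ellF Λ (-u) v = ellF Λ u v := by
    intro u
    rw [ellF, ellF, show -u + v = -(u - v) by ring, show -u - v = -(u + v) by ring,
      weierstrassZeta_neg, weierstrassZeta_neg]
    ring
  have hzp : ∀ p, p + v ∉ Λ.lattice → AnalyticAt ℂ (fun u => Λ.weierstrassZeta (u + v)) p :=
    fun p hp => (Λ.analyticAt_weierstrassZeta hp).comp_of_eq (by fun_prop) rfl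
  have hzm : ∀ p, p - v ∉ Λ.lattice → AnalyticAt ℂ (fun u => Λ.weierstrassZeta (u - v)) p :=
    fun p hp => (Λ.analyticAt_weierstrassZeta hp).comp_of_eq (by fun_prop) rfl
  have hFan : ∀ p, p + v ∉ Λ.lattice → p - v ∉ Λ.lattice →
      AnalyticAt ℂ (fun u => ellF Λ u v) p := fun p h1 h2 =>
    ((hzp p h1).sub (hzm p h2)).sub analyticAt_const
  have hFpole : HasSimplePoleWithResidue (fun u => ellF Λ u v) v (-1) := by
    have h1 : HasSimplePoleWithResidue (fun u => Λ.weierstrassZeta (u - v)) v 1 := by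
      simpa [sub_eq_add_neg] using HasSimplePoleWithResidue.comp_add (p := v) (l := -v)
        (by simpa using Λ.hasSimplePole_weierstrassZeta)
    have h2 := (h1.const_mul (-1)).add (HasSimplePoleWithResidue.of_analyticAt
      ((hzp v (by simpa [two_mul] using hv)).sub
        (analyticAt_const (v := 2 * Λ.weierstrassZeta v))))
    simp only [mul_one, add_zero] at h2
    refine h2.congr (Eventually.of_forall fun u => ?_)
    simp only [ellF, Pi.sub_apply]
    ring
  refine ⟨hFpole, ?_⟩
  obtain ⟨h, hh⟩ : ∃ h : ℂ → ℂ,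
      h = fun u => ellF Λ u v * (Λ.weierstrassP v - Λ.weierstrassP u) := ⟨_, rfl⟩
  have hper : IsEllipticPeriodic Λ h := by
    intro l hl p
    filter_upwards [Λ.eventually_sub_notMem_lattice p v, Λ.eventually_sub_notMem_lattice p (-v)]
      with u h1 h2
    have h3 := Λ.weierstrassP_add_coe u ⟨l, hl⟩
    simp only at h3
    rw [hh]
    simp only [hsubper l hl u (by simpa using h2) h1, h3]
  have hPan : ∀ p ∉ Λ.lattice, AnalyticAt ℂ (fun u => Λ.weierstrassP v - Λ.weierstrassP u) p :=
    fun p hp => analyticAt_const.sub (Λ.analyticOnNhd_weierstrassP p hp)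
  have han : ∀ p, p ∉ Λ.lattice → p + v ∉ Λ.lattice → p - v ∉ Λ.lattice → AnalyticAt ℂ h p := by
    intro p h0 h1 h2
    rw [hh]
    exact (hFan p h1 h2).mul (hPan p h0)
  obtain ⟨m, hm, hmv, hhm⟩ := hFpole.exists_mul_eq (hPan v hv1) (sub_self _)
  have hmv' : m v = Λ.derivWeierstrassP v := by
    rw [hmv, deriv_const_sub, deriv_weierstrassP]
    ring
  have hhv : ∀ᶠ u in 𝓝[≠] v, h u = m u := by rw [hh]; exact hhm
  have hremv : IsRemovableAt h v := ⟨m, hm, hhv⟩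
  have hremv' : IsRemovableAt h (-v) := by
    refine (IsRemovableAt.comp_neg (p := -v) (by simpa using hremv)).congr ?_
    refine Eventually.of_forall fun u => ?_
    simp only [hh, heven, weierstrassP_neg]
  have hrem0 : IsRemovableAt h 0 := by
    have ha : AnalyticAt ℂ (fun u => ellF Λ u v) 0 :=
      hFan 0 (by simpa using hv1) (by simpa using hv1)
    have h0 : ellF Λ 0 v = 0 := by
      rw [ellF, zero_add, zero_sub, weierstrassZeta_neg]
      ring
    have hd : deriv (fun u => ellF Λ u v) 0 = 0 := by
      have h1 := (Λ.hasDerivAt_weierstrassZeta (z := 0 + v) (by simpa using hv1)).comp_add_const 0 v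
      have h2 := (Λ.hasDerivAt_weierstrassZeta (z := 0 - v) (by simpa using hv1)).comp_sub_const 0 v
      have h3 := ((h1.sub h2).sub_const (2 * Λ.weierstrassZeta v)).deriv
      exact h3.trans (by simp)
    obtain ⟨k, hk, hk0, hfk⟩ := ha.exists_eq_sub_mul h0
    obtain ⟨j, hj, -, hkj⟩ := hk.exists_eq_sub_mul (hk0.trans hd)
    refine ⟨fun u => j u * (u ^ 2 * (Λ.weierstrassP v - Λ.weierstrassPExcept 0 u) - 1), ?_, ?_⟩
    · have := Λ.analyticAt_weierstrassPExcept 0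
      fun_prop
    · filter_upwards [self_mem_nhdsWithin] with u hu
      have hu' : u ≠ 0 := hu
      simp only [hh, hfk, hkj, Λ.weierstrassP_eq u]
      field
  obtain ⟨c, hc, hc'⟩ := hper.liouville fun p => by
    by_cases h0 : p ∈ Λ.lattice
    · simpa using hper.isRemovableAt_add h0 hrem0
    by_cases h1 : p + v ∈ Λ.lattice
    · simpa using hper.isRemovableAt_add h1 hremv'
    by_cases h2 : p - v ∈ Λ.lattice
    · simpa using hper.isRemovableAt_add h2 hremv
    exact (han p h0 h1 h2).isRemovableAt
  have hcv : Λ.derivWeierstrassP v = c := by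
    rw [← hmv']
    refine eq_of_eventuallyEq_punctured hm.continuousAt continuousAt_const ?_
    filter_upwards [hhv, hc v] with u h1 h2
    rw [← h1, h2]
  intro u h0 h1 h2
  rw [hcv, ← hc' u (han u h0 h1 h2).continuousAt, hh]

/-- If `℘'(v) = 0`, the product in `ellF_mul` vanishes; but `F` is nonzero near its pole `u = v`, so
`℘` would be constant there. No count of zeros of `℘'` is needed. -/
theorem derivWeierstrassP_ne_zero {v : ℂ} (hv : 2 * v ∉ Λ.lattice) :
    Λ.derivWeierstrassP v ≠ 0 := by
  intro h
  obtain ⟨h1, h2⟩ := Λ.ellF_mul hv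
  have hv1 := Λ.notMem_lattice_of_two_mul hv
  refine Λ.weierstrassP_not_eventually_const (c := Λ.weierstrassP v) hv1 ?_
  filter_upwards [h1.eventually_ne_zero (by norm_num), Λ.eventually_notMem_lattice v,
    Λ.eventually_sub_notMem_lattice v v, Λ.eventually_sub_notMem_lattice v (-v)] with u h3 h4 h5 h6
  have h7 := h2 u h4 (by simpa using h6) h5
  rw [h] at h7
  exact (sub_eq_zero.1 ((mul_eq_zero.1 h7).resolve_left h3)).symm

theorem weierstrassP_ne {u v : ℂ} (hv : 2 * v ∉ Λ.lattice) (hu : u ∉ Λ.lattice)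
    (h1 : u + v ∉ Λ.lattice) (h2 : u - v ∉ Λ.lattice) : Λ.weierstrassP u ≠ Λ.weierstrassP v := by
  intro h
  have h3 := (Λ.ellF_mul hv).2 u hu h1 h2
  rw [h, sub_self, mul_zero] at h3
  exact Λ.derivWeierstrassP_ne_zero hv h3.symm

theorem ellF_eq {u v : ℂ} (hv : 2 * v ∉ Λ.lattice) (hu : u ∉ Λ.lattice)
    (h1 : u + v ∉ Λ.lattice) (h2 : u - v ∉ Λ.lattice) :
    ellF Λ u v = Λ.derivWeierstrassP v / (Λ.weierstrassP v - Λ.weierstrassP u) :=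
  eq_div_of_mul_eq (sub_ne_zero.2 (Λ.weierstrassP_ne hv hu h1 h2).symm)
    ((Λ.ellF_mul hv).2 u hu h1 h2)

end PeriodPair

/-! ### Elliptic functions with simple poles at `0` and `±t`. -/

theorem HasSimplePoleWithResidue.of_div {N D : ℂ → ℂ} {p : ℂ} (hN : AnalyticAt ℂ N p)
    (hD : AnalyticAt ℂ D p) (h0 : D p = 0) (hd : deriv D p ≠ 0) :
    HasSimplePoleWithResidue (fun z => N z / D z) p (N p / deriv D p) := by
  obtain ⟨k, hk, hkp, hDk⟩ := hD.exists_eq_sub_mul h0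
  have hkp0 : k p ≠ 0 := by rwa [hkp]
  have hm : AnalyticAt ℂ (fun z => N z / k z - N p / k p) p := (hN.div hk hkp0).sub analyticAt_const
  obtain ⟨j, hj, -, hmj⟩ := hm.exists_eq_sub_mul (sub_self _)
  refine ⟨j, hj, ?_⟩
  filter_upwards [self_mem_nhdsWithin, nhdsWithin_le_nhds (hk.continuousAt.eventually_ne hkp0)]
    with z hz hkz
  have hz' : z - p ≠ 0 := sub_ne_zero.2 hz
  have h1 := hmj z
  rw [sub_eq_iff_eq_add] at h1
  rw [hDk, ← hkp, mul_comm, ← div_div, h1, add_div, mul_div_cancel_left₀ _ hz', add_comm]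

namespace PeriodPair

variable (Λ : PeriodPair)

/-- The elliptic function `1 / (℘ - ℘(t))`. -/
noncomputable def invP (t z : ℂ) : ℂ := 1 / (Λ.weierstrassP z - Λ.weierstrassP t)

/-- The elliptic function `℘' / (℘ - ℘(t))`. -/
noncomputable def logDerivP (t z : ℂ) : ℂ :=
  Λ.derivWeierstrassP z / (Λ.weierstrassP z - Λ.weierstrassP t)

variable {Λ} {t : ℂ}

theorem invP_add {l : ℂ} (hl : l ∈ Λ.lattice) (z : ℂ) : Λ.invP t (z + l) = Λ.invP t z := by
  have h := Λ.weierstrassP_add_coe z ⟨l, hl⟩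
  simp only at h
  rw [invP, invP, h]

theorem logDerivP_add {l : ℂ} (hl : l ∈ Λ.lattice) (z : ℂ) :
    Λ.logDerivP t (z + l) = Λ.logDerivP t z := by
  have h := Λ.weierstrassP_add_coe z ⟨l, hl⟩
  have h' := Λ.derivWeierstrassP_add_coe z ⟨l, hl⟩
  simp only at h h'
  rw [logDerivP, logDerivP, h, h']

theorem analyticAt_weierstrassP_sub {z : ℂ} (hz : z ∉ Λ.lattice) (c : ℂ) :
    AnalyticAt ℂ (fun z => Λ.weierstrassP z - c) z :=
  (Λ.analyticOnNhd_weierstrassP z hz).sub analyticAt_const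

theorem weierstrassP_sub_ne_zero (ht : 2 * t ∉ Λ.lattice) {z : ℂ} (hz : z ∉ Λ.lattice)
    (h1 : z - t ∉ Λ.lattice) (h2 : z + t ∉ Λ.lattice) :
    Λ.weierstrassP z - Λ.weierstrassP t ≠ 0 :=
  sub_ne_zero.2 (Λ.weierstrassP_ne ht hz h2 h1)

theorem analyticAt_invP (ht : 2 * t ∉ Λ.lattice) {z : ℂ} (hz : z ∉ Λ.lattice)
    (h1 : z - t ∉ Λ.lattice) (h2 : z + t ∉ Λ.lattice) : AnalyticAt ℂ (Λ.invP t) z :=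
  analyticAt_const.div (analyticAt_weierstrassP_sub hz _) (weierstrassP_sub_ne_zero ht hz h1 h2)

theorem analyticAt_logDerivP (ht : 2 * t ∉ Λ.lattice) {z : ℂ} (hz : z ∉ Λ.lattice)
    (h1 : z - t ∉ Λ.lattice) (h2 : z + t ∉ Λ.lattice) : AnalyticAt ℂ (Λ.logDerivP t) z :=
  (Λ.analyticOnNhd_derivWeierstrassP z hz).div (analyticAt_weierstrassP_sub hz _)
    (weierstrassP_sub_ne_zero ht hz h1 h2)

theorem invP_pole (ht : 2 * t ∉ Λ.lattice) :
    HasSimplePoleWithResidue (Λ.invP t) t (1 / Λ.derivWeierstrassP t) := by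
  have h := HasSimplePoleWithResidue.of_div (p := t) (analyticAt_const (v := (1 : ℂ)))
    (analyticAt_weierstrassP_sub (Λ.notMem_lattice_of_two_mul ht) (Λ.weierstrassP t)) (sub_self _)
    (by simpa using Λ.derivWeierstrassP_ne_zero ht)
  rwa [deriv_sub_const, deriv_weierstrassP] at h

theorem invP_pole_neg (ht : 2 * t ∉ Λ.lattice) :
    HasSimplePoleWithResidue (Λ.invP t) (-t) (-(1 / Λ.derivWeierstrassP t)) := by
  have h := HasSimplePoleWithResidue.comp_neg (p := -t) (r := 1 / Λ.derivWeierstrassP t)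
    (by rw [neg_neg]; exact invP_pole ht)
  refine h.congr (Eventually.of_forall fun z => ?_)
  simp [invP]

theorem logDerivP_pole (ht : 2 * t ∉ Λ.lattice) :
    HasSimplePoleWithResidue (Λ.logDerivP t) t 1 := by
  have ht1 := Λ.notMem_lattice_of_two_mul ht
  have h := HasSimplePoleWithResidue.of_div (Λ.analyticOnNhd_derivWeierstrassP t ht1)
    (analyticAt_weierstrassP_sub ht1 (Λ.weierstrassP t)) (sub_self _)
    (by simpa using Λ.derivWeierstrassP_ne_zero ht)
  rwa [deriv_sub_const, deriv_weierstrassP, div_self (Λ.derivWeierstrassP_ne_zero ht)] at h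

theorem logDerivP_pole_neg (ht : 2 * t ∉ Λ.lattice) :
    HasSimplePoleWithResidue (Λ.logDerivP t) (-t) 1 := by
  have h := (HasSimplePoleWithResidue.comp_neg (p := -t) (r := 1)
    (by rw [neg_neg]; exact logDerivP_pole ht)).const_mul (-1)
  rw [neg_mul_neg, one_mul] at h
  refine h.congr (Eventually.of_forall fun z => ?_)
  simp [logDerivP, neg_div]

/-- Near the puncture `℘ - c` is this function divided by `z²`. Its value `1` at `0` makes it
invertible, which yields the expansions of `invP` and `logDerivP` there. -/
theorem analyticAt_denominator (c : ℂ) :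
    AnalyticAt ℂ (fun z => 1 + z ^ 2 * (Λ.weierstrassPExcept 0 z - c)) 0 := by
  have := Λ.analyticAt_weierstrassPExcept 0
  fun_prop

theorem eventually_denominator_ne_zero (c : ℂ) :
    ∀ᶠ z in 𝓝[≠] (0 : ℂ), 1 + z ^ 2 * (Λ.weierstrassPExcept 0 z - c) ≠ 0 :=
  nhdsWithin_le_nhds ((analyticAt_denominator c).continuousAt.eventually_ne (by simp))

theorem invP_zero : ∃ g : ℂ → ℂ, AnalyticAt ℂ g 0 ∧ g 0 = 0 ∧
    ∀ᶠ z in 𝓝[≠] 0, Λ.invP t z = g z := by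
  refine ⟨fun z => z ^ 2 / (1 + z ^ 2 * (Λ.weierstrassPExcept 0 z - Λ.weierstrassP t)), ?_, ?_, ?_⟩
  · exact AnalyticAt.div (by fun_prop) (analyticAt_denominator _) (by simp)
  · simp
  · filter_upwards [self_mem_nhdsWithin, eventually_denominator_ne_zero (Λ := Λ) (Λ.weierstrassP t)]
      with z hz hd
    have hz' : z ≠ 0 := hz
    have h : Λ.weierstrassP z - Λ.weierstrassP t =
        (1 + z ^ 2 * (Λ.weierstrassPExcept 0 z - Λ.weierstrassP t)) / z ^ 2 := by
      rw [Λ.weierstrassP_eq z]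
      field
    rw [invP, h, one_div_div]

theorem logDerivP_zero : ∃ g : ℂ → ℂ, AnalyticAt ℂ g 0 ∧ g 0 = 0 ∧
    ∀ᶠ z in 𝓝[≠] 0, Λ.logDerivP t z = -2 / z + g z := by
  refine ⟨fun z => (z ^ 2 * Λ.derivWeierstrassPExcept 0 z +
    2 * z * (Λ.weierstrassPExcept 0 z - Λ.weierstrassP t)) /
    (1 + z ^ 2 * (Λ.weierstrassPExcept 0 z - Λ.weierstrassP t)), ?_, ?_, ?_⟩
  · refine AnalyticAt.div ?_ (analyticAt_denominator _) (by simp)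
    have := Λ.analyticAt_weierstrassPExcept 0
    have := Λ.analyticAt_derivWeierstrassPExcept 0
    fun_prop
  · simp
  · filter_upwards [self_mem_nhdsWithin, eventually_denominator_ne_zero (Λ := Λ) (Λ.weierstrassP t)]
      with z hz hd
    have hz' : z ≠ 0 := hz
    have h : Λ.weierstrassP z - Λ.weierstrassP t =
        (1 + z ^ 2 * (Λ.weierstrassPExcept 0 z - Λ.weierstrassP t)) / z ^ 2 := by
      rw [Λ.weierstrassP_eq z]
      field
    rw [logDerivP, h, Λ.derivWeierstrassP_eq z]
    field

/-- The elliptic functions with at most simple poles at `0` and `±t`. -/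
theorem eq_of_three_simple_poles (ht : 2 * t ∉ Λ.lattice) {f g : ℂ → ℂ} {r₀ r₁ r₂ : ℂ}
    (hper : ∀ l ∈ Λ.lattice, ∀ z, z ∉ Λ.lattice → z - t ∉ Λ.lattice → z + t ∉ Λ.lattice →
      f (z + l) = f z)
    (han : ∀ z, z ∉ Λ.lattice → z - t ∉ Λ.lattice → z + t ∉ Λ.lattice → AnalyticAt ℂ f z)
    (h₁ : HasSimplePoleWithResidue f t r₁) (h₂ : HasSimplePoleWithResidue f (-t) r₂)
    (hg : AnalyticAt ℂ g 0) (h₀ : ∀ᶠ z in 𝓝[≠] 0, f z = r₀ / z + g z) :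
    r₀ + r₁ + r₂ = 0 ∧ ∀ z, z ∉ Λ.lattice → z - t ∉ Λ.lattice → z + t ∉ Λ.lattice →
      f z = g 0 + Λ.derivWeierstrassP t * (r₁ + r₀ / 2) * Λ.invP t z
        - r₀ / 2 * Λ.logDerivP t z := by
  have hq := Λ.derivWeierstrassP_ne_zero ht
  -- Since `logDerivP` is `-2/z + O(z)` at `0`, adding `r₀ / 2` times it removes the pole at `0` and
  -- shifts both residues at `±t` by `r₀ / 2`. As `invP` has residue `1 / ℘'(t)` at `t`, this `B`
  -- removes the pole at `t`. The whole sum `r₀ + r₁ + r₂` is left at `-t`.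
  obtain ⟨B, hB⟩ : ∃ B, B = Λ.derivWeierstrassP t * (r₁ + r₀ / 2) := ⟨_, rfl⟩
  obtain ⟨H, hH⟩ : ∃ H : ℂ → ℂ, H = fun z => f z + r₀ / 2 * Λ.logDerivP t z + -B * Λ.invP t z :=
    ⟨_, rfl⟩
  have hHper : IsEllipticPeriodic Λ H := by
    intro l hl p
    filter_upwards [Λ.eventually_notMem_lattice p, Λ.eventually_sub_notMem_lattice p t,
      Λ.eventually_sub_notMem_lattice p (-t)] with z h1 h2 h3
    simp only [hH, hper l hl z h1 h2 (by simpa using h3), invP_add hl, logDerivP_add hl]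
  have hHan : ∀ z, z ∉ Λ.lattice → z - t ∉ Λ.lattice → z + t ∉ Λ.lattice → AnalyticAt ℂ H z := by
    intro z h1 h2 h3
    rw [hH]
    exact ((han z h1 h2 h3).add (analyticAt_const.mul (analyticAt_logDerivP ht h1 h2 h3))).add
      (analyticAt_const.mul (analyticAt_invP ht h1 h2 h3))
  have hH1 : IsRemovableAt H t := by
    have h := (h₁.add ((logDerivP_pole ht).const_mul (r₀ / 2))).add ((invP_pole ht).const_mul (-B))
    have hz : r₁ + r₀ / 2 * 1 + -B * (1 / Λ.derivWeierstrassP t) = 0 := by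
      rw [hB]; field
    rw [hz] at h
    rw [hH]
    exact h.isRemovableAt
  have hH2 : HasSimplePoleWithResidue H (-t) (r₀ + r₁ + r₂) := by
    have h := (h₂.add ((logDerivP_pole_neg ht).const_mul (r₀ / 2))).add
      ((invP_pole_neg ht).const_mul (-B))
    have hz : r₂ + r₀ / 2 * 1 + -B * -(1 / Λ.derivWeierstrassP t) = r₀ + r₁ + r₂ := by
      rw [hB]; field
    rw [hz] at h
    rwa [hH]
  obtain ⟨m, hm, hm0, hHm⟩ : ∃ m : ℂ → ℂ, AnalyticAt ℂ m 0 ∧ m 0 = g 0 ∧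
      ∀ᶠ z in 𝓝[≠] 0, H z = m z := by
    obtain ⟨k₁, hk₁, hk₁0, h1⟩ := invP_zero (Λ := Λ) (t := t)
    obtain ⟨k₂, hk₂, hk₂0, h2⟩ := logDerivP_zero (Λ := Λ) (t := t)
    refine ⟨fun z => g z + r₀ / 2 * k₂ z + -B * k₁ z, by fun_prop, by simp [hk₁0, hk₂0], ?_⟩
    filter_upwards [h₀, h1, h2] with z h3 h4 h5
    simp only [hH, h3, h4, h5]
    ring
  -- Translation by `-t` carries the only remaining pole to the origin.
  have hres : r₀ + r₁ + r₂ = 0 := by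
    refine Λ.residue_eq_zero_of_single_pole (f := fun z => H (z + -t)) ?_ ?_ ?_
    · intro l hl p
      have := eventually_punctured_add (p := p) (l := -t) (hHper l hl (p + -t))
      filter_upwards [this] with z hz
      rw [add_right_comm, hz]
    · intro p hp
      refine IsRemovableAt.comp_add ?_
      by_cases h1 : p + -t ∈ Λ.lattice
      · simpa using hHper.isRemovableAt_add h1 ⟨m, hm, hHm⟩
      by_cases h2 : p + -t - t ∈ Λ.lattice
      · simpa using hHper.isRemovableAt_add h2 hH1
      · exact (hHan _ h1 h2 (by simpa using hp)).isRemovableAt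
    · exact HasSimplePoleWithResidue.comp_add (by simpa using hH2)
  rw [hres] at hH2
  obtain ⟨c, hc, hc'⟩ := hHper.liouville fun p => by
    by_cases h0 : p ∈ Λ.lattice
    · simpa using hHper.isRemovableAt_add h0 ⟨m, hm, hHm⟩
    by_cases h1 : p - t ∈ Λ.lattice
    · simpa using hHper.isRemovableAt_add h1 hH1
    by_cases h2 : p + t ∈ Λ.lattice
    · simpa using hHper.isRemovableAt_add h2 hH2.isRemovableAt
    exact (hHan p h0 h1 h2).isRemovableAt
  have hcg : g 0 = c := by
    rw [← hm0]
    refine eq_of_eventuallyEq_punctured hm.continuousAt continuousAt_const ?_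
    filter_upwards [hHm, hc 0] with z h1 h2
    rw [← h1, h2]
  refine ⟨hres, fun z h1 h2 h3 => ?_⟩
  have h4 := hc' z (hHan z h1 h2 h3).continuousAt
  simp only [hH] at h4
  rw [← hB]
  linear_combination h4 - hcg

end PeriodPair

/-! ### Difference operators -/

@[simp] theorem shiftOp_apply (i : ℤ) (φ : ℤ → ℂ) (n : ℤ) : shiftOp i φ n = φ (n + i) := rfl

@[simp] theorem mulOp_apply (u φ : ℤ → ℂ) (n : ℤ) : mulOp u φ n = u n * φ n := rfl

theorem bandOp_apply (N M : ℕ) (u : ℤ → ℤ → ℂ) (φ : ℤ → ℂ) (n : ℤ) :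
    bandOp N M u φ n = ∑ i ∈ Finset.Icc (-(N : ℤ)) (M : ℤ), u i n * φ (n + i) := by
  simp [bandOp, LinearMap.sum_apply, Finset.sum_apply]

@[simp] theorem schrodingerOp_apply (v c φ : ℤ → ℂ) (n : ℤ) :
    schrodingerOp v c φ n = φ (n + 1) + v n * φ n + c n * φ (n - 1) := by
  simp [schrodingerOp, sub_eq_add_neg]

/-- The value of `D φ` at `n` only depends on the values of `φ` near `n`. -/
def IsLocalOp (D : Module.End ℂ (ℤ → ℂ)) : Prop :=
  ∃ N : ℕ, ∀ (φ : ℤ → ℂ) (n : ℤ), (∀ k, n - N ≤ k → k ≤ n + N → φ k = 0) → D φ n = 0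

namespace IsLocalOp

variable {D D' : Module.End ℂ (ℤ → ℂ)}

theorem mulOp (u : ℤ → ℂ) : IsLocalOp (mulOp u) :=
  ⟨0, fun φ n h => by simp [h n]⟩

theorem shiftOp (i : ℤ) : IsLocalOp (shiftOp i) :=
  ⟨i.natAbs, fun φ n h => by simp [h (n + i) (by omega) (by omega)]⟩

theorem add (h : IsLocalOp D) (h' : IsLocalOp D') : IsLocalOp (D + D') := by
  obtain ⟨N, hN⟩ := h
  obtain ⟨M, hM⟩ := h'
  refine ⟨N + M, fun φ n hφ => ?_⟩
  rw [LinearMap.add_apply, Pi.add_apply, hN φ n fun k _ _ => hφ k (by lia) (by lia),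
    hM φ n fun k _ _ => hφ k (by lia) (by lia), add_zero]

theorem smul (a : ℂ) (h : IsLocalOp D) : IsLocalOp (a • D) := by
  obtain ⟨N, hN⟩ := h
  exact ⟨N, fun φ n hφ => by rw [LinearMap.smul_apply, Pi.smul_apply, hN φ n hφ, smul_zero]⟩

theorem sub (h : IsLocalOp D) (h' : IsLocalOp D') : IsLocalOp (D - D') := by
  rw [sub_eq_add_neg, ← neg_one_smul ℂ D']
  exact h.add (h'.smul _)

/-- Closure under composition lets polynomial identities between operators be tested on
Baker-Akhiezer functions without expanding their coefficients. -/
theorem mul (h : IsLocalOp D) (h' : IsLocalOp D') : IsLocalOp (D * D') := by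
  obtain ⟨N, hN⟩ := h
  obtain ⟨M, hM⟩ := h'
  refine ⟨N + M, fun φ n hφ => ?_⟩
  rw [Module.End.mul_apply]
  refine hN _ n fun k _ _ => hM φ k fun j _ _ => hφ j ?_ ?_ <;> push_cast <;> lia

theorem one : IsLocalOp 1 := ⟨0, fun φ n h => by simp [h n]⟩

theorem pow (h : IsLocalOp D) (k : ℕ) : IsLocalOp (D ^ k) := by
  induction k with
  | zero => simpa using one
  | succ k ih => rw [pow_succ]; exact ih.mul h

theorem schrodingerOp (v c : ℤ → ℂ) : IsLocalOp (schrodingerOp v c) :=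
  ((shiftOp 1).add (mulOp v)).add ((mulOp c).mul (shiftOp (-1)))

theorem of_isDifferenceOp (h : IsDifferenceOp D) : IsLocalOp D := by
  obtain ⟨N, M, u, rfl⟩ := h
  refine ⟨N + M, fun φ n hφ => ?_⟩
  rw [bandOp_apply]
  refine Finset.sum_eq_zero fun i hi => ?_
  rw [Finset.mem_Icc] at hi
  rw [hφ (n + i) (by push_cast; lia) (by push_cast; lia), mul_zero]

/-- The action of a local operator in terms of sequences supported at a single point. -/
theorem apply_eq_sum (N : ℕ)
    (hN : ∀ (φ : ℤ → ℂ) (n : ℤ), (∀ k, n - N ≤ k → k ≤ n + N → φ k = 0) → D φ n = 0)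
    (φ : ℤ → ℂ) (n : ℤ) (J : ℕ) (hJ : 2 * N + 1 ≤ J) :
    D φ n = ∑ j ∈ Finset.range J, φ (n - N + j) * D (Pi.single (n - N + j) 1) n := by
  have h := hN (φ - ∑ j ∈ Finset.range J, φ (n - N + j) • Pi.single (n - N + j) 1) n ?_
  · rw [map_sub, map_sum, Pi.sub_apply, Finset.sum_apply, sub_eq_zero] at h
    simpa using h
  · intro k h1 h2
    rw [Pi.sub_apply, Finset.sum_apply, sub_eq_zero, Finset.sum_eq_single (k - (n - N)).toNat]
    · have : n - N + ((k - (n - N)).toNat : ℤ) = k := by lia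
      rw [this]
      simp
    · intro j _ hj
      have : k ≠ n - N + j := by lia
      simp [this]
    · intro h3
      exact absurd (Finset.mem_range.2 (by lia)) h3

end IsLocalOp

/-! ### Linear recurrences -/

/-- Bijectivity of the steps allows iteration in both directions from time `0`; reindexing the maps
moves the base point to `m`. As `Int.negSucc k` is `-(k + 1)`, the backward orbit is read at `k +
1`. -/
theorem exists_orbit {W : Type*} (M : ℤ → W ≃ W) (m : ℤ) (w₀ : W) :
    ∃ w : ℤ → W, w m = w₀ ∧ ∀ n, w (n + 1) = M n (w n) := by
  have key : ∀ M : ℤ → W ≃ W, ∃ w : ℤ → W, w 0 = w₀ ∧ ∀ n, w (n + 1) = M n (w n) := by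
    intro M
    let fwd : ℕ → W := fun k => Nat.rec w₀ (fun k x => M k x) k
    let bwd : ℕ → W := fun k => Nat.rec w₀ (fun k x => (M (Int.negSucc k)).symm x) k
    refine ⟨fun n => match n with
      | Int.ofNat k => fwd k
      | Int.negSucc k => bwd (k + 1), rfl, fun n => ?_⟩
    match n with
    | Int.ofNat k => rfl
    | Int.negSucc 0 =>
      change w₀ = M (Int.negSucc 0) ((M (Int.negSucc 0)).symm w₀)
      simp
    | Int.negSucc (k + 1) =>
      change bwd (k + 1) = M (Int.negSucc (k + 1)) ((M (Int.negSucc (k + 1))).symm (bwd (k + 1)))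
      simp
  obtain ⟨w, hw, h⟩ := key fun n => M (n + m)
  refine ⟨fun n => w (n - m), by simpa using hw, fun n => ?_⟩
  have := h (n - m)
  rwa [sub_add_cancel, ← add_sub_right_comm] at this

theorem exists_recurrence_two {x y : ℤ → ℂ} (hx : ∀ n, x n ≠ 0) (m : ℤ) (a b : ℂ) :
    ∃ φ : ℤ → ℂ, φ m = a ∧ φ (m + 1) = b ∧ ∀ n, φ (n + 2) = x n * φ n + y n * φ (n + 1) := by
  obtain ⟨w, hw, h⟩ := exists_orbit (W := ℂ × ℂ) (fun n =>
    { toFun := fun u => (u.2, x n * u.1 + y n * u.2)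
      invFun := fun u => ((u.2 - y n * u.1) / x n, u.1)
      left_inv := fun u => by
        ext
        · simp [hx n]
        · simp
      right_inv := fun u => by
        ext
        · simp
        · simp [mul_div_cancel₀ _ (hx n)] }) m (a, b)
  simp only [Equiv.coe_fn_mk] at h
  refine ⟨fun n => (w n).1, by simp [hw], by simp [h, hw], fun n => ?_⟩
  change (w (n + 2)).1 = x n * (w n).1 + y n * (w (n + 1)).1
  rw [show n + 2 = n + 1 + 1 by ring, h (n + 1), h n]

theorem exists_recurrence_four {x₀ x₁ x₂ x₃ : ℤ → ℂ} (hx : ∀ n, x₀ n ≠ 0) (m : ℤ)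
    (a₀ a₁ a₂ a₃ : ℂ) :
    ∃ φ : ℤ → ℂ, φ m = a₀ ∧ φ (m + 1) = a₁ ∧ φ (m + 2) = a₂ ∧ φ (m + 3) = a₃ ∧ ∀ n,
      φ (n + 4) = x₀ n * φ n + x₁ n * φ (n + 1) + x₂ n * φ (n + 2) + x₃ n * φ (n + 3) := by
  obtain ⟨w, hw, h⟩ := exists_orbit (W := ℂ × ℂ × ℂ × ℂ) (fun n =>
    { toFun := fun u => (u.2.1, u.2.2.1, u.2.2.2,
        x₀ n * u.1 + x₁ n * u.2.1 + x₂ n * u.2.2.1 + x₃ n * u.2.2.2)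
      invFun := fun u => ((u.2.2.2 - x₁ n * u.1 - x₂ n * u.2.1 - x₃ n * u.2.2.1) / x₀ n,
        u.1, u.2.1, u.2.2.1)
      left_inv := fun u => by
        have := hx n
        ext <;> simp only
        field
      right_inv := fun u => by
        have := hx n
        ext <;> simp only
        field }) m (a₀, a₁, a₂, a₃)
  simp only [Equiv.coe_fn_mk] at h
  have h2 : ∀ n, w (n + 2) = _ := fun n => by rw [show n + 2 = n + 1 + 1 by ring, h (n + 1)]
  have h3 : ∀ n, w (n + 3) = _ := fun n => by rw [show n + 3 = n + 2 + 1 by ring, h (n + 2)]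
  have h4 : ∀ n, w (n + 4) = _ := fun n => by rw [show n + 4 = n + 3 + 1 by ring, h (n + 3)]
  refine ⟨fun n => (w n).1, by simp [hw], by simp [h, hw], by simp [h2, h, hw],
    by simp [h3, h2, h, hw], fun n => ?_⟩
  simp only [h4, h3, h2, h]

theorem eq_zero_of_recurrence_two {x y φ : ℤ → ℂ} (hx : ∀ n, x n ≠ 0)
    (h : ∀ n, φ (n + 2) = x n * φ n + y n * φ (n + 1)) {m : ℤ} (h0 : φ m = 0)
    (h1 : φ (m + 1) = 0) : φ = 0 := by
  have key : ∀ n, φ n = 0 ∧ φ (n + 1) = 0 := by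
    intro n
    induction n using Int.inductionOn' (b := m) with
    | zero => exact ⟨h0, h1⟩
    | succ k _ ih =>
      refine ⟨ih.2, ?_⟩
      rw [show k + 1 + 1 = k + 2 by ring, h k, ih.1, ih.2]
      ring
    | pred k _ ih =>
      have h2 := h (k - 1)
      rw [show k - 1 + 2 = k + 1 by ring, sub_add_cancel, ih.1, ih.2, mul_zero, add_zero] at h2
      refine ⟨(mul_eq_zero.1 h2.symm).resolve_left (hx _), ?_⟩
      rw [sub_add_cancel]
      exact ih.1
  exact funext fun n => (key n).1

theorem eq_zero_of_recurrence_four {x₀ x₁ x₂ x₃ φ : ℤ → ℂ} (hx : ∀ n, x₀ n ≠ 0)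
    (h : ∀ n, φ (n + 4) = x₀ n * φ n + x₁ n * φ (n + 1) + x₂ n * φ (n + 2) + x₃ n * φ (n + 3))
    {m : ℤ} (h0 : φ m = 0) (h1 : φ (m + 1) = 0) (h2 : φ (m + 2) = 0) (h3 : φ (m + 3) = 0) :
    φ = 0 := by
  have key : ∀ n, φ n = 0 ∧ φ (n + 1) = 0 ∧ φ (n + 2) = 0 ∧ φ (n + 3) = 0 := by
    intro n
    induction n using Int.inductionOn' (b := m) with
    | zero => exact ⟨h0, h1, h2, h3⟩
    | succ k _ ih =>
      obtain ⟨i0, i1, i2, i3⟩ := ih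
      refine ⟨i1, ?_, ?_, ?_⟩
      · rwa [show k + 1 + 1 = k + 2 by ring]
      · rwa [show k + 1 + 2 = k + 3 by ring]
      · rw [show k + 1 + 3 = k + 4 by ring, h k, i0, i1, i2, i3]
        ring
    | pred k _ ih =>
      obtain ⟨i0, i1, i2, i3⟩ := ih
      have h4 := h (k - 1)
      rw [show k - 1 + 4 = k + 3 by ring, show k - 1 + 3 = k + 2 by ring,
        show k - 1 + 2 = k + 1 by ring, sub_add_cancel, i0, i1, i2, i3] at h4
      have h5 : x₀ (k - 1) * φ (k - 1) = 0 := by linear_combination -h4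
      refine ⟨(mul_eq_zero.1 h5).resolve_left (hx _), ?_, ?_, ?_⟩
      · rwa [sub_add_cancel]
      · rwa [show k - 1 + 2 = k + 1 by ring]
      · rwa [show k - 1 + 3 = k + 2 by ring]
  exact funext fun n => (key n).1

/-- A local operator that annihilates, for all `z` in a set accumulating at `0`, all solutions of a
recurrence `φ (n + 2) = x n z * φ n + y n z * φ (n + 1)` with `y n z ~ 1 / z` as `z → 0` is zero. -/
theorem IsLocalOp.eq_zero_of_annihilates {D : Module.End ℂ (ℤ → ℂ)} (hD : IsLocalOp D)
    {x y : ℤ → ℂ → ℂ} {S : Set ℂ} [(𝓝[S] (0 : ℂ)).NeBot]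
    (hx0 : ∀ z ∈ S, ∀ n, x n z ≠ 0)
    (hx : ∀ n, Tendsto (fun z => z * x n z) (𝓝[S] 0) (𝓝 0))
    (hy : ∀ n, Tendsto (fun z => z * y n z) (𝓝[S] 0) (𝓝 1))
    (h : ∀ z ∈ S, ∀ φ : ℤ → ℂ, (∀ n, φ (n + 2) = x n z * φ n + y n z * φ (n + 1)) → D φ = 0) :
    D = 0 := by
  obtain ⟨N, hN⟩ := hD
  have hz0 : Tendsto (fun z : ℂ => z) (𝓝[S] 0) (𝓝 0) :=
    tendsto_id.mono_left nhdsWithin_le_nhds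
  have hN' : ∀ (φ : ℤ → ℂ) (n : ℤ), (∀ k, n - (N + 1 : ℕ) ≤ k → k ≤ n + (N + 1 : ℕ) → φ k = 0) →
      D φ n = 0 := fun φ n hφ => hN φ n fun k _ _ => hφ k (by push_cast; lia) (by push_cast; lia)
  have key : ∀ n k : ℤ, D (Pi.single k 1) n = 0 := by
    intro n
    -- The window is enlarged by one on each side, so that the initial value `φ m = 0` sits just
    -- left of the places that `D` can see from `n`.
    obtain ⟨m, hm⟩ : ∃ m, m = n - (N + 1 : ℕ) := ⟨_, rfl⟩
    have hex : ∀ z, ∃ φ : ℤ → ℂ, z ∈ S → φ m = 0 ∧ φ (m + 1) = 1 ∧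
        ∀ n, φ (n + 2) = x n z * φ n + y n z * φ (n + 1) := by
      intro z
      by_cases hz : z ∈ S
      · obtain ⟨φ, hφ⟩ := exists_recurrence_two (y := fun n => y n z) (hx0 z hz) m 0 1
        exact ⟨φ, fun _ => hφ⟩
      · exact ⟨0, fun h => absurd h hz⟩
    choose φ hφ using hex
    have hS : ∀ᶠ z in 𝓝[S] (0 : ℂ), z ∈ S := self_mem_nhdsWithin
    -- The solution with initial values `0, 1` grows like `φ (m + 1 + j) ~ z ^ (-j)`; the second
    -- limit carries the lower order term through the induction.
    have hlim : ∀ j : ℕ, Tendsto (fun z => z ^ j * φ z (m + 1 + j)) (𝓝[S] 0) (𝓝 1) ∧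
        Tendsto (fun z => z ^ j * φ z (m + j)) (𝓝[S] 0) (𝓝 0) := by
      intro j
      induction j with
      | zero =>
        constructor
        · refine tendsto_const_nhds.congr' ?_
          filter_upwards [hS] with z hz
          simp [(hφ z hz).2.1]
        · refine tendsto_const_nhds.congr' ?_
          filter_upwards [hS] with z hz
          simp [(hφ z hz).1]
      | succ j ih =>
        constructor
        · have h1 := ((hx (m + j)).mul ih.2).add ((hy (m + j)).mul ih.1)
          rw [mul_zero, zero_add, one_mul] at h1
          refine h1.congr' ?_
          filter_upwards [hS] with z hz
          push_cast
          rw [show m + 1 + (j + 1 : ℤ) = m + j + 2 by ring, (hφ z hz).2.2,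
            show m + 1 + (j : ℤ) = m + j + 1 by ring]
          ring
        · have h1 := hz0.mul ih.1
          rw [zero_mul] at h1
          refine h1.congr fun z => ?_
          push_cast
          rw [show m + 1 + (j : ℤ) = m + (j + 1) by ring]
          ring
    -- Distinct orders of growth force linear independence: after multiplication by `z ^ J` only the
    -- last term survives in the limit, so coefficients are removed from the top down.
    have hzero : ∀ J : ℕ, ∀ e : ℕ → ℂ,
        (∀ z ∈ S, ∑ j ∈ Finset.range J, φ z (m + 1 + j) * e j = 0) → ∀ j < J, e j = 0 := by
      intro J e
      induction J with
      | zero => simp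
      | succ J ih =>
        intro hsum
        have hJ : e J = 0 := by
          have h1 : Tendsto (fun z => ∑ j ∈ Finset.range J,
              z ^ (J - j) * (z ^ j * φ z (m + 1 + j)) * e j) (𝓝[S] 0) (𝓝 0) := by
            have h0 : ∑ j ∈ Finset.range J, (0 : ℂ) = 0 := Finset.sum_const_zero
            nth_rw 2 [← h0]
            refine tendsto_finsetSum _ fun j hj => ?_
            rw [Finset.mem_range] at hj
            have h2 := ((hz0.pow (J - j)).mul (hlim j).1).mul_const (e j)
            rwa [zero_pow (by lia), zero_mul, zero_mul] at h2
          have h2 := h1.add ((hlim J).1.mul_const (e J))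
          rw [zero_add, one_mul] at h2
          refine tendsto_nhds_unique h2 (tendsto_const_nhds.congr' ?_)
          filter_upwards [hS] with z hz
          have h3 := hsum z hz
          rw [Finset.sum_range_succ] at h3
          have h4 : ∀ j ∈ Finset.range J, z ^ (J - j) * (z ^ j * φ z (m + 1 + j)) * e j =
              z ^ J * (φ z (m + 1 + j) * e j) := by
            intro j hj
            rw [Finset.mem_range] at hj
            rw [← pow_sub_mul_pow z hj.le]
            ring
          rw [Finset.sum_congr rfl h4, ← Finset.mul_sum]
          linear_combination -z ^ J * h3
        intro j hj
        rcases Nat.lt_succ_iff_lt_or_eq.1 hj with h' | rfl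
        · refine ih (fun z hz => ?_) j h'
          have h3 := hsum z hz
          rwa [Finset.sum_range_succ, hJ, mul_zero, add_zero] at h3
        · exact hJ
    have hwin : ∀ j < 2 * N + 2, D (Pi.single (m + 1 + j) 1) n = 0 := by
      refine hzero (2 * N + 2) (fun j => D (Pi.single (m + 1 + j) 1) n) fun z hz => ?_
      have h1 := IsLocalOp.apply_eq_sum (N + 1) hN' (φ z) n (2 * N + 3) (by lia)
      rw [h z hz (φ z) (hφ z hz).2.2, Finset.sum_range_succ', ← hm] at h1
      simp only [Nat.cast_zero, add_zero, (hφ z hz).1, zero_mul, Pi.zero_apply] at h1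
      rw [h1]
      refine Finset.sum_congr rfl fun j _ => ?_
      push_cast
      rw [show m + (j + 1 : ℤ) = m + 1 + j by ring]
    intro k
    by_cases hk : n - N ≤ k ∧ k ≤ n + N
    · have h1 := hwin (k - (m + 1)).toNat (by lia)
      rwa [show m + 1 + ((k - (m + 1)).toNat : ℤ) = k by lia] at h1
    · refine hN _ n fun i h1 h2 => ?_
      have : i ≠ k := by rintro rfl; exact hk ⟨h1, h2⟩
      simp [this]
  refine LinearMap.ext fun φ => funext fun n => ?_
  rw [IsLocalOp.apply_eq_sum N hN φ n (2 * N + 1) le_rfl]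
  simp [key]

/-! ### The commuting operators -/

/-- `L₂² - P_n - P_{n-1}`. -/
noncomputable def quarticOp (P v c : ℤ → ℂ) : Module.End ℂ (ℤ → ℂ) :=
  schrodingerOp v c ^ 2 - mulOp P - mulOp (fun n => P (n - 1))

/-- The operator of order six that commutes with `quarticOp`. -/
noncomputable def sexticOp (P B v c : ℤ → ℂ) : Module.End ℂ (ℤ → ℂ) :=
  (-2 : ℂ) • (schrodingerOp v c * quarticOp P v c)
    + mulOp (fun n => 2 * P (n - 1)) * schrodingerOp v c
    + mulOp (fun n => 2 * c n * (P n - P (n - 1))) * shiftOp (-1)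
    + mulOp (fun n => 2 * B (n - 1))

/-- The relations between the coefficients `v`, `c` and the parameters: `(P_n, Q_n)` are points of
the curve `y² = 4 x³ - g₂ x - g₃`. -/
structure SpectralData (g₂ g₃ : ℂ) (P Q B v c : ℤ → ℂ) : Prop where
  P_ne : ∀ n, P (n + 1) ≠ P n
  Q_ne : ∀ n, Q n ≠ 0
  c_ne : ∀ n, c n ≠ 0
  curve : ∀ n, Q n ^ 2 = 4 * P n ^ 3 - g₂ * P n - g₃
  v_eq : ∀ n, v n * (P n - P (n - 1)) = B n + B (n - 1)
  c_eq : ∀ n, c (n + 1) * (P (n + 1) - P n) * (P n - P (n - 1)) = B n ^ 2 - Q n ^ 2 / 4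

/-- The second order recurrence satisfied by the Baker-Akhiezer function at the point `(p, q)`. -/
def IsBakerAkhiezer (P B v c : ℤ → ℂ) (p q : ℂ) (φ : ℤ → ℂ) : Prop :=
  ∀ n, (p - P n) * φ (n + 2) + c (n + 1) * (p - P (n + 1)) * φ n
    + (q / 2 - B n + v (n + 1) * (p - P n)) * φ (n + 1) = 0

theorem quarticOp_apply (P v c φ : ℤ → ℂ) (n : ℤ) :
    quarticOp P v c φ n = φ (n + 2) + (v n + v (n + 1)) * φ (n + 1)
      + (v n ^ 2 + c n + c (n + 1) - P n - P (n - 1)) * φ n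
      + c n * (v n + v (n - 1)) * φ (n - 1) + c n * c (n - 1) * φ (n - 2) := by
  simp only [quarticOp, LinearMap.sub_apply, Pi.sub_apply, pow_two, Module.End.mul_apply,
    schrodingerOp_apply, mulOp_apply]
  ring_nf

theorem sexticOp_apply (P B v c φ : ℤ → ℂ) (n : ℤ) :
    sexticOp P B v c φ n = -2 * schrodingerOp v c (quarticOp P v c φ) n
      + 2 * P (n - 1) * schrodingerOp v c φ n + 2 * c n * (P n - P (n - 1)) * φ (n - 1)
      + 2 * B (n - 1) * φ n := by
  simp only [sexticOp, LinearMap.add_apply, Pi.add_apply, LinearMap.smul_apply, Pi.smul_apply,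
    smul_eq_mul, Module.End.mul_apply, mulOp_apply, shiftOp_apply, ← sub_eq_add_neg]

theorem isLocalOp_quarticOp (P v c : ℤ → ℂ) : IsLocalOp (quarticOp P v c) :=
  (((IsLocalOp.schrodingerOp v c).pow 2).sub (.mulOp _)).sub (.mulOp _)

theorem isLocalOp_sexticOp (P B v c : ℤ → ℂ) : IsLocalOp (sexticOp P B v c) :=
  (((((IsLocalOp.schrodingerOp v c).mul (isLocalOp_quarticOp P v c)).smul _).add
    ((IsLocalOp.mulOp _).mul (.schrodingerOp v c))).add ((IsLocalOp.mulOp _).mul (.shiftOp _))).add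
    (.mulOp _)

theorem hasExactBand_quarticOp (P v : ℤ → ℂ) {c : ℤ → ℂ} (hc : ∀ n, c n ≠ 0) :
    HasExactBand 2 2 (quarticOp P v c) := by
  refine ⟨fun i n => if i = 2 then 1 else if i = 1 then v n + v (n + 1) else if i = 0 then
    v n ^ 2 + c n + c (n + 1) - P n - P (n - 1) else if i = -1 then c n * (v n + v (n - 1)) else
    c n * c (n - 1), fun n => by simp, fun n => by simp [hc], ?_⟩
  refine LinearMap.ext fun φ => funext fun n => ?_
  rw [quarticOp_apply, bandOp_apply,
    show Finset.Icc (-((2 : ℕ) : ℤ)) ((2 : ℕ) : ℤ) = {2, 1, 0, -1, -2} by decide]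
  simp [sub_eq_add_neg, add_assoc]

theorem hasExactBand_sexticOp (P B v : ℤ → ℂ) {c : ℤ → ℂ} (hc : ∀ n, c n ≠ 0) :
    HasExactBand 3 3 (sexticOp P B v c) := by
  refine ⟨fun i n => if i = 3 then -2 else
    if i = 2 then -2 * (v (n + 1) + v (n + 2) + v n) else
    if i = 1 then -2 * (v (n + 1) ^ 2 + c (n + 1) + c (n + 2) - P (n + 1) - P n
      + v n * (v n + v (n + 1)) + c n) + 2 * P (n - 1) else
    if i = 0 then -2 * (c (n + 1) * (v (n + 1) + v n)
      + v n * (v n ^ 2 + c n + c (n + 1) - P n - P (n - 1)) + c n * (v (n - 1) + v n))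
      + 2 * P (n - 1) * v n + 2 * B (n - 1) else
    if i = -1 then -2 * (c (n + 1) * c n + v n * (c n * (v n + v (n - 1)))
      + c n * (v (n - 1) ^ 2 + c (n - 1) + c n - P (n - 1) - P (n - 2)))
      + 2 * P (n - 1) * c n + 2 * c n * (P n - P (n - 1)) else
    if i = -2 then -2 * (v n * (c n * c (n - 1)) + c n * (c (n - 1) * (v (n - 1) + v (n - 2)))) else
    -2 * (c n * (c (n - 1) * c (n - 2))), fun n => by simp, fun n => by simp [hc], ?_⟩
  refine LinearMap.ext fun φ => funext fun n => ?_
  rw [sexticOp_apply, bandOp_apply,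
    show Finset.Icc (-((3 : ℕ) : ℤ)) ((3 : ℕ) : ℤ) = {3, 2, 1, 0, -1, -2, -3} by decide]
  simp only [schrodingerOp_apply, quarticOp_apply]
  simp
  ring_nf

/-! ### Eigenfunctions of the two operators and the rank. -/

section

variable {g₂ g₃ : ℂ} {P Q B v c : ℤ → ℂ} {p q : ℂ} {φ : ℤ → ℂ}

/-- With `U = L₂φ`, the recurrence expresses `(p - P n) * U (n + 1)` and `(p - P n) * U n` through
`φ n` and `φ (n + 1)`. Both `U (n + 2)` and `c (n + 1) * U n` can then be written in `U (n + 1)` and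
`φ (n + 1)`. In `L₂U` the terms with `U (n + 1)` cancel by `v_eq`; the terms with `φ (n + 1)` add up
to `p + P (n + 1) + P n`. -/
theorem SpectralData.quarticOp_eq (h : SpectralData g₂ g₃ P Q B v c)
    (hpq : q ^ 2 = 4 * p ^ 3 - g₂ * p - g₃) (hp : ∀ n, p ≠ P n)
    (hφ : IsBakerAkhiezer P B v c p q φ) : quarticOp P v c φ = p • φ := by
  funext m
  obtain ⟨n, rfl⟩ : ∃ n, m = n + 1 := ⟨m - 1, by ring⟩
  obtain ⟨U, hU⟩ : ∃ U, U = schrodingerOp v c φ := ⟨_, rfl⟩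
  have hUn : ∀ n, U n = φ (n + 1) + v n * φ n + c n * φ (n - 1) := fun n => by
    rw [hU, schrodingerOp_apply]
  have hU1 : ∀ n, (p - P n) * U (n + 1) =
      (B n - q / 2) * φ (n + 1) + c (n + 1) * (P (n + 1) - P n) * φ n := by
    intro n
    have h1 := hφ n
    rw [hUn, show n + 1 + 1 = n + 2 by ring, add_sub_cancel_right]
    linear_combination h1
  have hU0 : ∀ n, (p - P n) * U n = -(B n + q / 2) * φ n - (P n - P (n - 1)) * φ (n + 1) := by
    intro n
    have h1 := hU1 (n - 1)
    have h2 := hUn n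
    rw [sub_add_cancel] at h1
    linear_combination h1 - (P n - P (n - 1)) * h2 - φ n * h.v_eq n
  have hd := sub_ne_zero.2 (h.P_ne n)
  have hp0 := sub_ne_zero.2 (hp n)
  have hp1 := sub_ne_zero.2 (hp (n + 1))
  have e1 := hU1 n
  have e2 := hU1 (n + 1)
  have e3 := hU0 n
  have e4 := hU0 (n + 1)
  have hc0 := h.c_eq n
  have hc1 := h.c_eq (n + 1)
  have hv := h.v_eq (n + 1)
  simp only [add_sub_cancel_right, show n + 1 + 1 = n + 2 by ring] at e2 e4 hc1 hv
  have hgoal : quarticOp P v c φ (n + 1) = U (n + 2) + v (n + 1) * U (n + 1) + c (n + 1) * U n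
      - P (n + 1) * φ (n + 1) - P n * φ (n + 1) := by
    simp only [quarticOp, LinearMap.sub_apply, Pi.sub_apply, pow_two, Module.End.mul_apply,
      mulOp_apply, ← hU, schrodingerOp_apply v c U, add_sub_cancel_right,
      show n + 1 + 1 = n + 2 by ring]
  rw [hgoal, Pi.smul_apply, smul_eq_mul]
  -- eliminate `φ (n + 2)` and `φ n` in favour of `U (n + 1)` and `φ (n + 1)`
  have f1 : (p - P (n + 1)) * (P (n + 1) - P n) * U (n + 2) =
      -(B (n + 1) - q / 2) * (p - P (n + 1)) * U (n + 1)
        + (q ^ 2 - Q (n + 1) ^ 2) / 4 * φ (n + 1) := by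
    linear_combination (P (n + 1) - P n) * e2 + (B (n + 1) - q / 2) * e4 + φ (n + 1) * hc1
  have f2 : (p - P n) * (P (n + 1) - P n) * (c (n + 1) * U n) =
      -(B n + q / 2) * (p - P n) * U (n + 1) + (Q n ^ 2 - q ^ 2) / 4 * φ (n + 1) := by
    linear_combination c (n + 1) * (P (n + 1) - P n) * e3 + (B n + q / 2) * e1 - φ (n + 1) * hc0
  -- Both `(p, q)` and `(P, Q)` lie on the cubic, so the factor `p - P` can be split off and
  -- cancelled.
  have hq1 : q ^ 2 - Q (n + 1) ^ 2 = (p - P (n + 1)) *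
      (4 * (p ^ 2 + p * P (n + 1) + P (n + 1) ^ 2) - g₂) := by
    rw [hpq, h.curve]; ring
  have hq0 : Q n ^ 2 - q ^ 2 = -(p - P n) * (4 * (p ^ 2 + p * P n + P n ^ 2) - g₂) := by
    rw [hpq, h.curve]; ring
  rw [hq1] at f1
  rw [hq0] at f2
  have f1' : (P (n + 1) - P n) * U (n + 2) = -(B (n + 1) - q / 2) * U (n + 1)
      + (4 * (p ^ 2 + p * P (n + 1) + P (n + 1) ^ 2) - g₂) / 4 * φ (n + 1) :=
    mul_left_cancel₀ hp1 (by linear_combination f1)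
  have f2' : (P (n + 1) - P n) * (c (n + 1) * U n) = -(B n + q / 2) * U (n + 1)
      - (4 * (p ^ 2 + p * P n + P n ^ 2) - g₂) / 4 * φ (n + 1) :=
    mul_left_cancel₀ hp0 (by linear_combination f2)
  refine mul_left_cancel₀ hd ?_
  linear_combination f1' + f2' + U (n + 1) * hv

/-- This is where `A` comes from: `(A - q)φ` at `n + 1` is `-2` times the recurrence at `n`, once
`L₄φ` is replaced by `pφ`. -/
theorem sexticOp_eq_iff (hφ : quarticOp P v c φ = p • φ) :
    sexticOp P B v c φ = q • φ ↔ IsBakerAkhiezer P B v c p q φ := by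
  have key : ∀ n, sexticOp P B v c φ (n + 1) - q * φ (n + 1) =
      -2 * ((p - P n) * φ (n + 2) + c (n + 1) * (p - P (n + 1)) * φ n
        + (q / 2 - B n + v (n + 1) * (p - P n)) * φ (n + 1)) := by
    intro n
    rw [sexticOp_apply, hφ]
    simp only [schrodingerOp_apply, Pi.smul_apply, smul_eq_mul, add_sub_cancel_right,
      show n + 1 + 1 = n + 2 by ring]
    ring
  constructor
  · intro h n
    have h1 := key n
    rw [h, Pi.smul_apply, smul_eq_mul, sub_self] at h1
    linear_combination h1 / 2
  · intro h
    funext m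
    have h1 := key (m - 1)
    rw [h (m - 1), sub_add_cancel, mul_zero, sub_eq_zero] at h1
    exact h1

theorem isBakerAkhiezer_iff (hp : ∀ n, p ≠ P n) : IsBakerAkhiezer P B v c p q φ ↔
    ∀ n, φ (n + 2) = -c (n + 1) * (p - P (n + 1)) / (p - P n) * φ n
      + (-(q / 2 - B n) / (p - P n) - v (n + 1)) * φ (n + 1) := by
  refine forall_congr' fun n => ?_
  have hp0 := sub_ne_zero.2 (hp n)
  constructor
  · intro h
    refine mul_left_cancel₀ hp0 ?_
    field_simp
    linear_combination 2 * h
  · intro h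
    rw [h]
    field

theorem SpectralData.mem_commonEigenspace_iff (h : SpectralData g₂ g₃ P Q B v c)
    (hpq : q ^ 2 = 4 * p ^ 3 - g₂ * p - g₃) (hp : ∀ n, p ≠ P n) :
    φ ∈ commonEigenspace (quarticOp P v c) (sexticOp P B v c) p q ↔
      IsBakerAkhiezer P B v c p q φ := by
  rw [commonEigenspace, Submodule.mem_inf, Module.End.mem_eigenspace_iff,
    Module.End.mem_eigenspace_iff]
  constructor
  · rintro ⟨h1, h2⟩
    exact (sexticOp_eq_iff h1).1 h2
  · intro h1
    have h2 := h.quarticOp_eq hpq hp h1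
    exact ⟨h2, (sexticOp_eq_iff h2).2 h1⟩

/-- Evaluation of sequences at finitely many places. -/
def evalAt {k : ℕ} (V : Submodule ℂ (ℤ → ℂ)) (m : Fin k → ℤ) : V →ₗ[ℂ] (Fin k → ℂ) :=
  (LinearMap.funLeft ℂ ℂ m).comp V.subtype

theorem evalAt_injective {k : ℕ} {V : Submodule ℂ (ℤ → ℂ)} {m : Fin k → ℤ}
    (h : ∀ φ ∈ V, (∀ i, φ (m i) = 0) → φ = 0) : Function.Injective (evalAt V m) := by
  rw [← LinearMap.ker_eq_bot, LinearMap.ker_eq_bot']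
  intro φ hφ
  exact Subtype.ext (h φ.1 φ.2 fun i => congrFun hφ i)

theorem finrank_eq_of_evalAt {k : ℕ} {V : Submodule ℂ (ℤ → ℂ)} {m : Fin k → ℤ}
    (h : ∀ φ ∈ V, (∀ i, φ (m i) = 0) → φ = 0)
    (h' : ∀ a : Fin k → ℂ, ∃ φ ∈ V, ∀ i, φ (m i) = a i) : Module.finrank ℂ V = k := by
  have e := LinearEquiv.ofBijective (evalAt V m) ⟨evalAt_injective h, fun a => by
    obtain ⟨φ, hφ, ha⟩ := h' a
    exact ⟨⟨φ, hφ⟩, funext ha⟩⟩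
  rw [e.finrank_eq, Module.finrank_fin_fun]

theorem SpectralData.finrank_generic (h : SpectralData g₂ g₃ P Q B v c)
    (hpq : q ^ 2 = 4 * p ^ 3 - g₂ * p - g₃) (hp : ∀ n, p ≠ P n) :
    Module.finrank ℂ (commonEigenspace (quarticOp P v c) (sexticOp P B v c) p q) = 2 := by
  have hx : ∀ n, -c (n + 1) * (p - P (n + 1)) / (p - P n) ≠ 0 := fun n =>
    div_ne_zero (mul_ne_zero (neg_ne_zero.2 (h.c_ne _)) (sub_ne_zero.2 (hp _)))
      (sub_ne_zero.2 (hp n))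
  refine finrank_eq_of_evalAt (m := ![0, 1]) (fun φ hφ h0 => ?_) fun a => ?_
  · rw [h.mem_commonEigenspace_iff hpq hp, isBakerAkhiezer_iff hp] at hφ
    exact eq_zero_of_recurrence_two hx hφ (m := 0) (h0 0) (h0 1)
  · obtain ⟨φ, h0, h1, h2⟩ := exists_recurrence_two (y := fun n =>
      -(q / 2 - B n) / (p - P n) - v (n + 1)) hx 0 (a 0) (a 1)
    refine ⟨φ, ?_, fun i => ?_⟩
    · rwa [h.mem_commonEigenspace_iff hpq hp, isBakerAkhiezer_iff hp]
    · fin_cases i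
      · exact h0
      · exact h1

theorem quarticOp_eigen_iff : quarticOp P v c φ = p • φ ↔ ∀ n, φ (n + 4) =
    -(c (n + 2) * c (n + 1)) * φ n + -(c (n + 2) * (v (n + 2) + v (n + 1))) * φ (n + 1)
    + (p - (v (n + 2) ^ 2 + c (n + 2) + c (n + 3) - P (n + 2) - P (n + 1))) * φ (n + 2)
    + -(v (n + 2) + v (n + 3)) * φ (n + 3) := by
  have key : ∀ n, quarticOp P v c φ (n + 2) = φ (n + 4) + (v (n + 2) + v (n + 3)) * φ (n + 3)
      + (v (n + 2) ^ 2 + c (n + 2) + c (n + 3) - P (n + 2) - P (n + 1)) * φ (n + 2)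
      + c (n + 2) * (v (n + 2) + v (n + 1)) * φ (n + 1) + c (n + 2) * c (n + 1) * φ n := by
    intro n
    rw [quarticOp_apply]
    ring_nf
  constructor
  · intro h n
    have h1 := key n
    rw [h, Pi.smul_apply, smul_eq_mul] at h1
    linear_combination -h1
  · intro h
    funext m
    have h1 := key (m - 2)
    rw [h (m - 2), sub_add_cancel] at h1
    rw [h1, Pi.smul_apply, smul_eq_mul]
    ring

theorem finrank_eigenspace_quarticOp (hc : ∀ n, c n ≠ 0) :
    Module.finrank ℂ (Module.End.eigenspace (quarticOp P v c) p) = 4 := by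
  have hx : ∀ n, -(c (n + 2) * c (n + 1)) ≠ 0 := fun n =>
    neg_ne_zero.2 (mul_ne_zero (hc _) (hc _))
  refine finrank_eq_of_evalAt (m := ![0, 1, 2, 3]) (fun φ hφ h0 => ?_) fun a => ?_
  · rw [Module.End.mem_eigenspace_iff, quarticOp_eigen_iff] at hφ
    exact eq_zero_of_recurrence_four hx hφ (m := 0) (h0 0) (h0 1) (h0 2) (h0 3)
  · obtain ⟨φ, h0, h1, h2, h3, h4⟩ := exists_recurrence_four
      (x₁ := fun n => -(c (n + 2) * (v (n + 2) + v (n + 1))))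
      (x₂ := fun n => p - (v (n + 2) ^ 2 + c (n + 2) + c (n + 3) - P (n + 2) - P (n + 1)))
      (x₃ := fun n => -(v (n + 2) + v (n + 3))) hx 0 (a 0) (a 1) (a 2) (a 3)
    refine ⟨φ, ?_, fun i => ?_⟩
    · rwa [Module.End.mem_eigenspace_iff, quarticOp_eigen_iff]
    · fin_cases i
      · exact h0
      · exact h1
      · exact h2
      · exact h3

/-- A common eigenfunction over a Tyurin point is determined by two of its values. -/
theorem SpectralData.eq_zero_of_tyurin (h : SpectralData g₂ g₃ P Q B v c) {k : ℤ} (hp : p = P k)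
    (hφ : φ ∈ commonEigenspace (quarticOp P v c) (sexticOp P B v c) p q)
    (h0 : φ (k - 1) = 0) (h1 : φ k = 0) : φ = 0 := by
  rw [commonEigenspace, Submodule.mem_inf, Module.End.mem_eigenspace_iff,
    Module.End.mem_eigenspace_iff] at hφ
  obtain ⟨hL, hA⟩ := hφ
  have hR := (sexticOp_eq_iff hL).1 hA
  have hx : ∀ n, -(c (n + 2) * c (n + 1)) ≠ 0 := fun n =>
    neg_ne_zero.2 (mul_ne_zero (h.c_ne _) (h.c_ne _))
  have hPk : P k - P (k - 1) ≠ 0 := by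
    have := h.P_ne (k - 1)
    rw [sub_add_cancel] at this
    exact sub_ne_zero.2 this
  -- The recurrence loses its leading term at `n = k`, so it is used only at `n = k - 1` and `n = k
  -- - 2`, where the unknown value has a coefficient containing `P k - P (k - 1) ≠ 0`. This gives
  -- four consecutive zeros, from which the fourth order recurrence of `L₄` takes over.
  have r1 := hR (k - 1)
  rw [show k - 1 + 2 = k + 1 by ring, sub_add_cancel, h0, h1, hp] at r1
  have h2 : φ (k + 1) = 0 := by
    refine (mul_eq_zero.1 (?_ : (P k - P (k - 1)) * φ (k + 1) = 0)).resolve_left hPk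
    linear_combination r1
  have r2 := hR (k - 2)
  rw [show k - 2 + 2 = k by ring, show k - 2 + 1 = k - 1 by ring, h0, h1, hp] at r2
  have h3 : φ (k - 2) = 0 := by
    refine (mul_eq_zero.1 (?_ : c (k - 1) * (P k - P (k - 1)) * φ (k - 2) = 0)).resolve_left
      (mul_ne_zero (h.c_ne _) hPk)
    linear_combination r2
  rw [quarticOp_eigen_iff] at hL
  refine eq_zero_of_recurrence_four hx hL (m := k - 2) h3 ?_ ?_ ?_
  · rwa [show k - 2 + 1 = k - 1 by ring]
  · rwa [show k - 2 + 2 = k by ring]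
  · rwa [show k - 2 + 3 = k + 1 by ring]

theorem finite_of_evalAt {k : ℕ} {V : Submodule ℂ (ℤ → ℂ)} {m : Fin k → ℤ}
    (h : ∀ φ ∈ V, (∀ i, φ (m i) = 0) → φ = 0) :
    Module.Finite ℂ V ∧ Module.finrank ℂ V ≤ k := by
  have hinj := evalAt_injective h
  refine ⟨Module.Finite.of_injective _ hinj, ?_⟩
  simpa using LinearMap.finrank_le_finrank_of_injective hinj

/-- The recurrence only bounds each common eigenspace, for `q` and for `-q`, by 2. Equality is a
count: `A` preserves the four-dimensional eigenspace of `L₄` and squares to `q²` on it, with `q ≠ 0`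
because `Q k ≠ 0`, so that space is the sum of the two. -/
theorem SpectralData.finrank_tyurin (h : SpectralData g₂ g₃ P Q B v c)
    (hpq : q ^ 2 = 4 * p ^ 3 - g₂ * p - g₃) {k : ℤ} (hp : p = P k)
    (hcomm : Commute (quarticOp P v c) (sexticOp P B v c))
    (hsq : sexticOp P B v c ^ 2 = 4 * quarticOp P v c ^ 3 - g₂ • quarticOp P v c
      - g₃ • (1 : Module.End ℂ (ℤ → ℂ))) :
    Module.finrank ℂ (commonEigenspace (quarticOp P v c) (sexticOp P B v c) p q) = 2 := by
  have hq : q ≠ 0 := by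
    intro h0
    apply h.Q_ne k
    have h1 := h.curve k
    rw [← hp, ← hpq, h0] at h1
    simpa using h1
  have hle : ∀ q', Module.Finite ℂ
      (commonEigenspace (quarticOp P v c) (sexticOp P B v c) p q') ∧
      Module.finrank ℂ (commonEigenspace (quarticOp P v c) (sexticOp P B v c) p q') ≤ 2 :=
    fun q' => finite_of_evalAt (m := ![k - 1, k]) fun φ hφ h0 =>
      h.eq_zero_of_tyurin hp hφ (h0 0) (h0 1)
  obtain ⟨hf1, h1⟩ := hle q
  obtain ⟨hf2, h2⟩ := hle (-q)
  have hsup : Module.End.eigenspace (quarticOp P v c) p ≤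
      commonEigenspace (quarticOp P v c) (sexticOp P B v c) p q ⊔
      commonEigenspace (quarticOp P v c) (sexticOp P B v c) p (-q) := by
    intro φ hφ
    rw [Module.End.mem_eigenspace_iff] at hφ
    have hLA : quarticOp P v c (sexticOp P B v c φ) = p • sexticOp P B v c φ := by
      rw [← Module.End.mul_apply, hcomm.eq, Module.End.mul_apply, hφ, map_smul]
    have hAA : sexticOp P B v c (sexticOp P B v c φ) = q ^ 2 • φ := by
      rw [← Module.End.mul_apply, ← pow_two, hsq, hpq]
      have h3 : ((4 : Module.End ℂ (ℤ → ℂ)) * quarticOp P v c ^ 3) φ = (4 * p ^ 3) • φ := by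
        rw [Module.End.mul_apply, Module.End.ofNat_apply, pow_succ, pow_two]
        simp only [Module.End.mul_apply, hφ, map_smul]
        module
      simp only [LinearMap.sub_apply, LinearMap.smul_apply, Module.End.one_apply, h3, hφ, smul_smul,
        sub_smul]
    rw [Submodule.mem_sup]
    -- The components are the projections `(1 ± A / q) / 2` onto the eigenspaces of `A`.
    refine ⟨(1 / 2 : ℂ) • φ + (1 / (2 * q)) • sexticOp P B v c φ, ?_,
      (1 / 2 : ℂ) • φ - (1 / (2 * q)) • sexticOp P B v c φ, ?_, ?_⟩
    · rw [commonEigenspace, Submodule.mem_inf, Module.End.mem_eigenspace_iff,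
        Module.End.mem_eigenspace_iff]
      simp only [map_add, map_smul, hφ, hLA, hAA]
      constructor
      · module
      · match_scalars <;> field
    · rw [commonEigenspace, Submodule.mem_inf, Module.End.mem_eigenspace_iff,
        Module.End.mem_eigenspace_iff]
      simp only [map_sub, map_smul, hφ, hLA, hAA]
      constructor
      · module
      · match_scalars <;> field
    · module
  have h3 := Submodule.finrank_mono hsup
  rw [finrank_eigenspace_quarticOp h.c_ne] at h3
  have h4 := Submodule.finrank_add_le_finrank_add_finrank
    (commonEigenspace (quarticOp P v c) (sexticOp P B v c) p q)
    (commonEigenspace (quarticOp P v c) (sexticOp P B v c) p (-q))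
  omega

end

/-! ### Tyurin dynamics on the curve -/

section

variable {Λ : PeriodPair} {γ : ℤ → ℂ} {a : Fin 2 → ℤ → ℂ} {c v : ℤ → ℂ}
  {X : ℤ → ℂ → Matrix (Fin 2) (Fin 2) ℂ}

/-- The spectral data on the curve of `Λ` attached to the points `γ`. -/
abbrev LatticeSpectralData (Λ : PeriodPair) (γ B v c : ℤ → ℂ) : Prop :=
  SpectralData Λ.g₂ Λ.g₃ (fun n => Λ.weierstrassP (γ n)) (fun n => Λ.derivWeierstrassP (γ n)) B v c

theorem weierstrassP_succ_ne (hγ : ∀ n, 2 * γ n ∉ Λ.lattice)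
    (hadd : ∀ n, γ (n + 1) + γ n ∉ Λ.lattice) (hsub : ∀ n, γ (n + 1) - γ n ∉ Λ.lattice) (n : ℤ) :
    Λ.weierstrassP (γ (n + 1)) ≠ Λ.weierstrassP (γ n) :=
  Λ.weierstrassP_ne (hγ n) (Λ.notMem_lattice_of_two_mul (hγ _)) (hadd n) (hsub n)

theorem weierstrassP_sub_pred_ne_zero (hγ : ∀ n, 2 * γ n ∉ Λ.lattice)
    (hadd : ∀ n, γ (n + 1) + γ n ∉ Λ.lattice) (hsub : ∀ n, γ (n + 1) - γ n ∉ Λ.lattice) (n : ℤ) :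
    Λ.weierstrassP (γ n) - Λ.weierstrassP (γ (n - 1)) ≠ 0 := by
  have h := weierstrassP_succ_ne hγ hadd hsub (n - 1)
  rw [sub_add_cancel] at h
  exact sub_ne_zero.2 h

theorem sub_tyurin_notMem_iff {z : ℂ} {n : ℤ} :
    (∀ s, z - (![γ, -γ] : Fin 2 → ℤ → ℂ) s n ∉ Λ.lattice) ↔
      z - γ n ∉ Λ.lattice ∧ z + γ n ∉ Λ.lattice := by
  simp [Fin.forall_fin_two]

/-- The classification of three-pole functions leaves constants `E n` and `B n`. Both residue
conditions and both null vector conditions become polynomial equations in them, and elimination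
leaves exactly the spectral data. -/
theorem IsTyurinDynamics.exists_spectralData (hγ : ∀ n, 2 * γ n ∉ Λ.lattice)
    (hadd : ∀ n, γ (n + 1) + γ n ∉ Λ.lattice) (hsub : ∀ n, γ (n + 1) - γ n ∉ Λ.lattice)
    (hX : IsTyurinDynamics Λ ![γ, -γ] a c v X) :
    ∃ B : ℤ → ℂ, LatticeSpectralData Λ γ B v c ∧
      (∀ n, a 0 n * (Λ.weierstrassP (γ n) - Λ.weierstrassP (γ (n - 1))) =
        B n + Λ.derivWeierstrassP (γ n) / 2) ∧
      (∀ n, a 1 n * (Λ.weierstrassP (γ n) - Λ.weierstrassP (γ (n - 1))) =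
        B n - Λ.derivWeierstrassP (γ n) / 2) ∧
      ∀ n z, z ∉ Λ.lattice → z - γ n ∉ Λ.lattice → z + γ n ∉ Λ.lattice →
        X n z 1 0 = -c (n + 1) + c (n + 1) *
          (Λ.weierstrassP (γ (n + 1)) - Λ.weierstrassP (γ n)) * Λ.invP (γ n) z ∧
        X n z 1 1 = -v (n + 1) + B n * Λ.invP (γ n) z - 1 / 2 * Λ.logDerivP (γ n) z := by
  have hmem := fun n => Λ.notMem_lattice_of_two_mul (hγ n)
  have hq := fun n => Λ.derivWeierstrassP_ne_zero (hγ n)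
  have hd := weierstrassP_sub_pred_ne_zero hγ hadd hsub
  -- the entries of `X`
  have hform : ∀ n, ∃ E B : ℂ, a 0 n * (B - Λ.derivWeierstrassP (γ n) / 2) = E ∧
      a 1 n * (B + Λ.derivWeierstrassP (γ n) / 2) = E ∧
      ∀ z, z ∉ Λ.lattice → z - γ n ∉ Λ.lattice → z + γ n ∉ Λ.lattice →
        X n z 1 0 = -c (n + 1) + E * Λ.invP (γ n) z ∧
        X n z 1 1 = -v (n + 1) + B * Λ.invP (γ n) z - 1 / 2 * Λ.logDerivP (γ n) z := by
    intro n
    obtain ⟨ρ, hρ, hρa⟩ := hX.tyurin_pole n 0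
    obtain ⟨σ, hσ, hσa⟩ := hX.tyurin_pole n 1
    obtain ⟨g, hg, hg0, hXg⟩ := hX.puncture_left n
    obtain ⟨k, hk, hk0, hXk⟩ := hX.puncture_right n
    have hper : ∀ j, ∀ l ∈ Λ.lattice, ∀ z, z ∉ Λ.lattice → z - γ n ∉ Λ.lattice →
        z + γ n ∉ Λ.lattice → X n (z + l) 1 j = X n z 1 j := fun j l hl z h1 h2 h3 => by
      rw [hX.periodic n z l hl h1 (sub_tyurin_notMem_iff.2 ⟨h2, h3⟩)]
    have han : ∀ j z, z ∉ Λ.lattice → z - γ n ∉ Λ.lattice → z + γ n ∉ Λ.lattice →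
        AnalyticAt ℂ (fun w => X n w 1 j) z := fun j z h1 h2 h3 =>
      hX.analytic n z h1 (sub_tyurin_notMem_iff.2 ⟨h2, h3⟩) 1 j
    obtain ⟨hres1, h1⟩ := PeriodPair.eq_of_three_simple_poles (hγ n) (r₀ := 0) (hper 0) (han 0)
      (hρ 1 0) (hσ 1 0) hg (hXg.mono fun z hz => by rw [hz, zero_div, zero_add])
    obtain ⟨hres2, h2⟩ := PeriodPair.eq_of_three_simple_poles (hγ n) (r₀ := 1) (hper 1) (han 1)
      (hρ 1 1) (hσ 1 1) hk (hXk.mono fun z hz => by rw [hz, one_div])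
    have hρ2 := hρa 1 1 0
    have hσ2 := hσa 1 1 0
    simp only [Matrix.cons_val_zero, Matrix.cons_val_one, one_mul] at hρ2 hσ2
    refine ⟨Λ.derivWeierstrassP (γ n) * ρ 1 0, Λ.derivWeierstrassP (γ n) * (ρ 1 1 + 1 / 2),
      ?_, ?_, fun z hz1 hz2 hz3 => ⟨?_, ?_⟩⟩
    · rw [← hρ2]; ring
    · linear_combination Λ.derivWeierstrassP (γ n) * (a 1 n * hres2 - hres1 - hσ2)
    · rw [h1 z hz1 hz2 hz3, hg0]; ring
    · rw [h2 z hz1 hz2 hz3, hk0]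
  choose E B h0 h1 hform using hform
  -- the values at the next Tyurin points
  have hstep : ∀ n, E n = c (n + 1) * (Λ.weierstrassP (γ (n + 1)) - Λ.weierstrassP (γ n)) ∧
      a 0 (n + 1) * (Λ.weierstrassP (γ (n + 1)) - Λ.weierstrassP (γ n)) =
        v (n + 1) * (Λ.weierstrassP (γ (n + 1)) - Λ.weierstrassP (γ n))
          - (B n - Λ.derivWeierstrassP (γ (n + 1)) / 2) ∧
      a 1 (n + 1) * (Λ.weierstrassP (γ (n + 1)) - Λ.weierstrassP (γ n)) =
        v (n + 1) * (Λ.weierstrassP (γ (n + 1)) - Λ.weierstrassP (γ n))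
          - (B n + Λ.derivWeierstrassP (γ (n + 1)) / 2) := by
    intro n
    have hne := sub_ne_zero.2 (weierstrassP_succ_ne hγ hadd hsub n)
    have hrow : ∀ z, X n z 0 0 = 0 ∧ X n z 0 1 = 1 := fun z => by
      simp [hX.first_row n z]
    -- The first column at `-γ (n + 1)` is omitted: `invP` is even, so it repeats the equation at `γ
    -- (n + 1)`.
    have hs0 := hX.tyurin_step n 0
    have hs1 := hX.tyurin_step n 1
    have e0 := congrFun hs0 0
    have e1 := congrFun hs0 1
    have e2 := congrFun hs1 1
    simp only [Matrix.vecMul, dotProduct, Fin.sum_univ_two, Matrix.cons_val_zero,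
      Matrix.cons_val_one, hrow, Pi.zero_apply, Pi.neg_apply, mul_zero, zero_add, one_mul,
      mul_one] at e0 e1 e2
    obtain ⟨f0, f1⟩ := hform n (γ (n + 1)) (hmem _) (hsub n) (hadd n)
    obtain ⟨-, f2⟩ := hform n (-γ (n + 1)) (Λ.neg_notMem_lattice (hmem _))
      (by rw [← neg_add']; exact Λ.neg_notMem_lattice (hadd n))
      (by rw [neg_add_eq_sub, ← neg_sub]; exact Λ.neg_notMem_lattice (hsub n))
    rw [f0] at e0
    rw [f1] at e1
    rw [f2] at e2
    simp only [PeriodPair.invP, PeriodPair.logDerivP, PeriodPair.weierstrassP_neg,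
      PeriodPair.derivWeierstrassP_neg] at e0 e1 e2
    field_simp at e0 e1 e2
    refine ⟨?_, ?_, ?_⟩
    · linear_combination e0
    · linear_combination e1 / 2
    · linear_combination e2 / 2
  have hstep' : ∀ n, a 0 n * (Λ.weierstrassP (γ n) - Λ.weierstrassP (γ (n - 1))) =
        v n * (Λ.weierstrassP (γ n) - Λ.weierstrassP (γ (n - 1)))
          - (B (n - 1) - Λ.derivWeierstrassP (γ n) / 2) ∧
      a 1 n * (Λ.weierstrassP (γ n) - Λ.weierstrassP (γ (n - 1))) =
        v n * (Λ.weierstrassP (γ n) - Λ.weierstrassP (γ (n - 1)))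
          - (B (n - 1) + Λ.derivWeierstrassP (γ n) / 2) := by
    intro n
    have h := (hstep (n - 1)).2
    rwa [sub_add_cancel] at h
  -- Inserting the null vector values of `a 0 n` and `a 1 n` into the two residue expressions for `E
  -- n` and equating them gives `℘'(γ n)` times the relation.
  have hv : ∀ n, v n * (Λ.weierstrassP (γ n) - Λ.weierstrassP (γ (n - 1))) = B n + B (n - 1) := by
    intro n
    refine mul_left_cancel₀ (hq n) ?_
    obtain ⟨s0, s1⟩ := hstep' n
    linear_combination (Λ.weierstrassP (γ n) - Λ.weierstrassP (γ (n - 1))) * (h1 n - h0 n)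
      + (B n - Λ.derivWeierstrassP (γ n) / 2) * s0 - (B n + Λ.derivWeierstrassP (γ n) / 2) * s1
  have ha0 : ∀ n, a 0 n * (Λ.weierstrassP (γ n) - Λ.weierstrassP (γ (n - 1))) =
      B n + Λ.derivWeierstrassP (γ n) / 2 := fun n => by
    linear_combination (hstep' n).1 + hv n
  have ha1 : ∀ n, a 1 n * (Λ.weierstrassP (γ n) - Λ.weierstrassP (γ (n - 1))) =
      B n - Λ.derivWeierstrassP (γ n) / 2 := fun n => by
    linear_combination (hstep' n).2 + hv n
  refine ⟨B, ⟨weierstrassP_succ_ne hγ hadd hsub, hq, hX.c_ne_zero,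
    fun n => Λ.derivWeierstrassP_sq _ (hmem n), hv, fun n => ?_⟩, ha0, ha1,
    fun n z hz1 hz2 hz3 => ?_⟩
  · linear_combination (-(Λ.weierstrassP (γ n) - Λ.weierstrassP (γ (n - 1)))) * ((hstep n).1 + h0 n)
      + (B n - Λ.derivWeierstrassP (γ n) / 2) * ha0 n
  · rw [← (hstep n).1]
    exact hform n z hz1 hz2 hz3

/-- The transfer matrices with prescribed spectral data. -/
noncomputable def transferMatrix (Λ : PeriodPair) (γ B v c : ℤ → ℂ) (n : ℤ) (z : ℂ) :
    Matrix (Fin 2) (Fin 2) ℂ :=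
  !![0, 1;
    -c (n + 1) + c (n + 1) * (Λ.weierstrassP (γ (n + 1)) - Λ.weierstrassP (γ n)) * Λ.invP (γ n) z,
    -v (n + 1) + B n * Λ.invP (γ n) z - 1 / 2 * Λ.logDerivP (γ n) z]

/-- The elimination runs backwards: `c_eq` factors its right side as `(B - Q/2)(B + Q/2)`, so `a 0 n
* (B n - Q n / 2)` and `a 1 n * (B n + Q n / 2)` are the same number `E n`, which is the residue
condition at both points. The null vector condition is `v_eq`, together with the choice of `E n`. -/
theorem SpectralData.isTyurinDynamics (hγ : ∀ n, 2 * γ n ∉ Λ.lattice) {B : ℤ → ℂ}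
    (h : LatticeSpectralData Λ γ B v c)
    (ha0 : ∀ n, a 0 n * (Λ.weierstrassP (γ n) - Λ.weierstrassP (γ (n - 1))) =
        B n + Λ.derivWeierstrassP (γ n) / 2)
    (ha1 : ∀ n, a 1 n * (Λ.weierstrassP (γ n) - Λ.weierstrassP (γ (n - 1))) =
        B n - Λ.derivWeierstrassP (γ n) / 2) :
    IsTyurinDynamics Λ ![γ, -γ] a c v (transferMatrix Λ γ B v c) := by
  obtain ⟨E, hE⟩ : ∃ E : ℤ → ℂ,
      E = fun n => c (n + 1) * (Λ.weierstrassP (γ (n + 1)) - Λ.weierstrassP (γ n)) := ⟨_, rfl⟩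
  have hX : ∀ n z, transferMatrix Λ γ B v c n z = !![0, 1; -c (n + 1) + E n * Λ.invP (γ n) z,
      -v (n + 1) + B n * Λ.invP (γ n) z - 1 / 2 * Λ.logDerivP (γ n) z] := fun n z => by
    rw [hE, transferMatrix]
  have hd : ∀ n, Λ.weierstrassP (γ n) - Λ.weierstrassP (γ (n - 1)) ≠ 0 := fun n => by
    have := h.P_ne (n - 1)
    rw [sub_add_cancel] at this
    exact sub_ne_zero.2 this
  have hE0 : ∀ n, a 0 n * (B n - Λ.derivWeierstrassP (γ n) / 2) = E n := fun n => by
    refine mul_left_cancel₀ (hd n) ?_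
    have := h.c_eq n
    rw [hE]
    linear_combination (B n - Λ.derivWeierstrassP (γ n) / 2) * ha0 n - this
  have hE1 : ∀ n, a 1 n * (B n + Λ.derivWeierstrassP (γ n) / 2) = E n := fun n => by
    refine mul_left_cancel₀ (hd n) ?_
    have := h.c_eq n
    rw [hE]
    linear_combination (B n + Λ.derivWeierstrassP (γ n) / 2) * ha1 n - this
  have hpole0 : ∀ n (r : ℂ) (b e f : ℂ) (p s : ℂ), HasSimplePoleWithResidue (Λ.invP (γ n)) p r →
      HasSimplePoleWithResidue (Λ.logDerivP (γ n)) p s →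
      HasSimplePoleWithResidue (fun z => b + e * Λ.invP (γ n) z + f * Λ.logDerivP (γ n) z) p
        (e * r + f * s) := by
    intro n r b e f p s h1 h2
    have h3 := ((HasSimplePoleWithResidue.of_analyticAt (p := p)
      (analyticAt_const (v := b))).add (h1.const_mul e)).add (h2.const_mul f)
    rwa [zero_add] at h3
  refine
    { first_row := fun n z => ?_
      periodic := fun n z l hl _ _ => ?_
      analytic := fun n z hz1 hz2 i j => ?_
      puncture_left := fun n => ?_
      puncture_right := fun n => ?_
      tyurin_pole := fun n s => ?_
      tyurin_step := fun n s => ?_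
      c_ne_zero := h.c_ne }
  · rw [hX]
    rfl
  · rw [hX, hX, PeriodPair.invP_add hl, PeriodPair.logDerivP_add hl]
  · obtain ⟨hz3, hz4⟩ := sub_tyurin_notMem_iff.1 hz2
    have h1 := PeriodPair.analyticAt_invP (hγ n) hz1 hz3 hz4
    have h2 := PeriodPair.analyticAt_logDerivP (hγ n) hz1 hz3 hz4
    simp only [hX]
    fin_cases i <;> fin_cases j
    · exact analyticAt_const
    · exact analyticAt_const
    · exact analyticAt_const.add (analyticAt_const.mul h1)
    · exact (analyticAt_const.add (analyticAt_const.mul h1)).sub (analyticAt_const.mul h2)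
  · obtain ⟨g, hg, hg0, hgz⟩ := PeriodPair.invP_zero (Λ := Λ) (t := γ n)
    refine ⟨fun z => -c (n + 1) + E n * g z, by fun_prop, by simp [hg0], ?_⟩
    filter_upwards [hgz] with z hz
    simp [hX, hz]
  · obtain ⟨g, hg, hg0, hgz⟩ := PeriodPair.invP_zero (Λ := Λ) (t := γ n)
    obtain ⟨k, hk, hk0, hkz⟩ := PeriodPair.logDerivP_zero (Λ := Λ) (t := γ n)
    refine ⟨fun z => -v (n + 1) + B n * g z - 1 / 2 * k z, by fun_prop, by simp [hg0, hk0], ?_⟩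
    filter_upwards [hgz, hkz] with z hz hz'
    simp only [hX, Matrix.of_apply, Matrix.cons_val_one, Matrix.cons_val_fin_one, hz, hz']
    ring
  · have hq := h.Q_ne n
    have key : ∀ (p r : ℂ), HasSimplePoleWithResidue (Λ.invP (γ n)) p r →
        HasSimplePoleWithResidue (Λ.logDerivP (γ n)) p 1 → E n * r = a s n * (B n * r - 1 / 2) →
        ∃ ρ : Matrix (Fin 2) (Fin 2) ℂ,
          (∀ m i, HasSimplePoleWithResidue (fun z => transferMatrix Λ γ B v c n z m i) p (ρ m i)) ∧
          ∀ m i j, (![a s n, 1] : Fin 2 → ℂ) j * ρ m i = (![a s n, 1] : Fin 2 → ℂ) i * ρ m j := by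
      intro p r h1 h2 h3
      refine ⟨!![0, 0; E n * r, B n * r - 1 / 2], fun m i => ?_, fun m i j => ?_⟩
      · simp only [hX]
        fin_cases m <;> fin_cases i
        · exact .of_analyticAt analyticAt_const
        · exact .of_analyticAt analyticAt_const
        · have h4 := hpole0 n r (-c (n + 1)) (E n) 0 p 1 h1 h2
          simpa using h4
        · have h4 := hpole0 n r (-v (n + 1)) (B n) (-(1 / 2)) p 1 h1 h2
          rw [mul_one, ← sub_eq_add_neg] at h4
          refine h4.congr (Eventually.of_forall fun z => ?_)
          simp only [Matrix.of_apply, Matrix.cons_val', Matrix.cons_val_fin_one, Fin.mk_one,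
            Matrix.cons_val_one]
          ring
      · fin_cases m <;> fin_cases i <;> fin_cases j <;> simp [h3]
    have hs : s = 0 ∨ s = 1 := by lia
    rcases hs with rfl | rfl
    · refine key _ _ (PeriodPair.invP_pole (hγ n)) (PeriodPair.logDerivP_pole (hγ n)) ?_
      rw [← hE0]; field
    · refine key _ _ (PeriodPair.invP_pole_neg (hγ n)) (PeriodPair.logDerivP_pole_neg (hγ n)) ?_
      rw [← hE1]; field
  · have hne := sub_ne_zero.2 (h.P_ne n)
    have hv := h.v_eq (n + 1)
    have h0 := ha0 (n + 1)
    have h1 := ha1 (n + 1)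
    simp only [add_sub_cancel_right] at hv h0 h1
    have hE' : E n = c (n + 1) * (Λ.weierstrassP (γ (n + 1)) - Λ.weierstrassP (γ n)) := by rw [hE]
    have hs : s = 0 ∨ s = 1 := by lia
    funext j
    simp only [hX, Matrix.vecMul, dotProduct, Fin.sum_univ_two]
    rcases hs with rfl | rfl <;> fin_cases j
    · simp [PeriodPair.invP, hE', hne]
    · simp only [Matrix.cons_val_zero, Matrix.cons_val_one, Matrix.of_apply, Fin.mk_one,
        Matrix.cons_val_fin_one, PeriodPair.invP, PeriodPair.logDerivP, Pi.zero_apply]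
      field_simp
      linear_combination 2 * h0 - 2 * hv
    · simp [PeriodPair.invP, hE', hne]
    · simp only [Matrix.cons_val_zero, Matrix.cons_val_one, Matrix.of_apply, Fin.mk_one,
        Matrix.cons_val_fin_one, PeriodPair.invP, PeriodPair.logDerivP, Pi.zero_apply, Pi.neg_apply,
        PeriodPair.weierstrassP_neg, PeriodPair.derivWeierstrassP_neg]
      field_simp
      linear_combination 2 * h1 - 2 * hv

end

/-! ### Operator identities from the Baker-Akhiezer function. -/

section

variable {Λ : PeriodPair} {γ : ℤ → ℂ} {a : Fin 2 → ℤ → ℂ} {B c v : ℤ → ℂ}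
  {X : ℤ → ℂ → Matrix (Fin 2) (Fin 2) ℂ}

/-- The points of the curve other than the puncture and the Tyurin points. -/
def genericSet (Λ : PeriodPair) (γ : ℤ → ℂ) : Set ℂ :=
  {z | z ∉ Λ.lattice ∧ ∀ n, z - γ n ∉ Λ.lattice ∧ z + γ n ∉ Λ.lattice}

/-- Nothing keeps the points `±γ n + Λ` from accumulating at the puncture, so a punctured disc may
contain no usable disc. They are countably many, however, and the complement of a countable set is
dense. -/
theorem neBot_nhdsWithin_genericSet (Λ : PeriodPair) (γ : ℤ → ℂ) :
    (𝓝[genericSet Λ γ] (0 : ℂ)).NeBot := by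
  have hΛ : (Λ.lattice : Set ℂ).Countable := by
    have : Countable Λ.lattice := Λ.latticeEquivProd.toEquiv.countable_iff.2 inferInstance
    exact Set.countable_coe_iff.1 this
  have hc : ((Λ.lattice : Set ℂ) ∪ ⋃ n, ((fun z => z - γ n) ⁻¹' (Λ.lattice : Set ℂ) ∪
      (fun z => z + γ n) ⁻¹' (Λ.lattice : Set ℂ))).Countable := by
    refine hΛ.union (Set.countable_iUnion fun n => ?_)
    exact (hΛ.preimage (sub_left_injective (b := γ n))).union
      (hΛ.preimage (add_left_injective (γ n)))
  have hd := hc.dense_compl ℂ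
  rw [← mem_closure_iff_nhdsWithin_neBot]
  refine closure_mono (fun z hz => ?_) (hd 0)
  simp only [Set.mem_compl_iff, Set.mem_union, Set.mem_iUnion, Set.mem_preimage, SetLike.mem_coe,
    not_or, not_exists] at hz
  exact hz

theorem nhdsWithin_genericSet_le (Λ : PeriodPair) (γ : ℤ → ℂ) :
    𝓝[genericSet Λ γ] (0 : ℂ) ≤ 𝓝[≠] 0 := by
  refine nhdsWithin_mono _ fun z hz => ?_
  rintro rfl
  exact hz.1 (zero_mem _)

theorem weierstrassP_ne_of_mem_genericSet (hγ : ∀ n, 2 * γ n ∉ Λ.lattice) {z : ℂ}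
    (hz : z ∈ genericSet Λ γ) (n : ℤ) : Λ.weierstrassP z ≠ Λ.weierstrassP (γ n) :=
  Λ.weierstrassP_ne (hγ n) hz.1 (hz.2 n).2 (hz.2 n).1

/-- A difference operator is determined by its action on the Baker-Akhiezer function. -/
theorem IsLocalOp.eq_zero_of_isBakerAkhiezer (hγ : ∀ n, 2 * γ n ∉ Λ.lattice)
    (hc : ∀ n, c n ≠ 0) {D : Module.End ℂ (ℤ → ℂ)} (hD : IsLocalOp D)
    (h : ∀ z ∈ genericSet Λ γ, ∀ φ, IsBakerAkhiezer (fun n => Λ.weierstrassP (γ n)) B v c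
      (Λ.weierstrassP z) (Λ.derivWeierstrassP z) φ → D φ = 0) : D = 0 := by
  have := neBot_nhdsWithin_genericSet Λ γ
  have hne := fun z hz n => weierstrassP_ne_of_mem_genericSet (z := z) hγ hz n
  have hS : ∀ᶠ z in 𝓝[genericSet Λ γ] (0 : ℂ), z ∈ genericSet Λ γ := self_mem_nhdsWithin
  have hz0 : Tendsto (fun z : ℂ => z) (𝓝[genericSet Λ γ] 0) (𝓝 0) :=
    tendsto_id.mono_left nhdsWithin_le_nhds
  have hinv : ∀ n, Tendsto (Λ.invP (γ n)) (𝓝[genericSet Λ γ] 0) (𝓝 0) := by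
    intro n
    obtain ⟨g, hg, hg0, hgz⟩ := PeriodPair.invP_zero (Λ := Λ) (t := γ n)
    have h1 : Tendsto g (𝓝[genericSet Λ γ] 0) (𝓝 0) := by
      simpa [hg0] using hg.continuousAt.tendsto.mono_left nhdsWithin_le_nhds
    exact h1.congr' ((hgz.filter_mono (nhdsWithin_genericSet_le Λ γ)).mono fun z hz => hz.symm)
  have hlog : ∀ n, Tendsto (fun z => z * Λ.logDerivP (γ n) z) (𝓝[genericSet Λ γ] 0) (𝓝 (-2)) := by
    intro n
    obtain ⟨g, hg, hg0, hgz⟩ := PeriodPair.logDerivP_zero (Λ := Λ) (t := γ n)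
    have h1 : ContinuousAt (fun z => -2 + z * g z) 0 := by
      have := hg.continuousAt
      fun_prop
    have h2 : Tendsto (fun z => -2 + z * g z) (𝓝[≠] 0) (𝓝 (-2)) := by
      simpa using h1.tendsto.mono_left nhdsWithin_le_nhds
    refine (h2.congr' ?_).mono_left (nhdsWithin_genericSet_le Λ γ)
    filter_upwards [hgz, self_mem_nhdsWithin] with z h3 h4
    have h5 : z ≠ 0 := h4
    rw [h3]
    field
  -- The coefficient `x` is `-c (n + 1)` plus a multiple of `invP`, hence bounded at `0`; in `y` the
  -- term `-logDerivP / 2` contributes the leading `1 / z`.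
  refine hD.eq_zero_of_annihilates (S := genericSet Λ γ)
    (x := fun n z => -c (n + 1) * (Λ.weierstrassP z - Λ.weierstrassP (γ (n + 1))) /
      (Λ.weierstrassP z - Λ.weierstrassP (γ n)))
    (y := fun n z => -(Λ.derivWeierstrassP z / 2 - B n) /
      (Λ.weierstrassP z - Λ.weierstrassP (γ n)) - v (n + 1))
    (fun z hz n => ?_) (fun n => ?_) (fun n => ?_) (fun z hz φ hφ => ?_)
  · exact div_ne_zero (mul_ne_zero (neg_ne_zero.2 (hc _)) (sub_ne_zero.2 (hne z hz _)))
      (sub_ne_zero.2 (hne z hz _))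
  · have h1 := hz0.mul (((hinv n).const_mul (c (n + 1) *
      (Λ.weierstrassP (γ (n + 1)) - Λ.weierstrassP (γ n)))).add_const (-c (n + 1)))
    rw [zero_mul] at h1
    refine h1.congr' ?_
    filter_upwards [hS] with z hz
    have h2 := sub_ne_zero.2 (hne z hz n)
    rw [PeriodPair.invP]
    field
  · have h1 := ((hlog n).const_mul (-1 / 2)).add
      (hz0.mul (((hinv n).const_mul (B n)).add_const (-v (n + 1))))
    have h2 : (-1 / 2 : ℂ) * -2 + 0 * (B n * 0 + -v (n + 1)) = 1 := by ring
    rw [h2] at h1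
    refine h1.congr' ?_
    filter_upwards [hS] with z hz
    have h3 := sub_ne_zero.2 (hne z hz n)
    rw [PeriodPair.invP, PeriodPair.logDerivP]
    field
  · exact h z hz φ ((isBakerAkhiezer_iff fun n => hne z hz n).2 hφ)

theorem LatticeSpectralData.quarticOp_eq (hγ : ∀ n, 2 * γ n ∉ Λ.lattice)
    (h : LatticeSpectralData Λ γ B v c) {z : ℂ} (hz : z ∈ genericSet Λ γ) {φ : ℤ → ℂ}
    (hφ : IsBakerAkhiezer (fun n => Λ.weierstrassP (γ n)) B v c
      (Λ.weierstrassP z) (Λ.derivWeierstrassP z) φ) :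
    fourthOrderOp Λ γ v c φ = Λ.weierstrassP z • φ :=
  SpectralData.quarticOp_eq h (Λ.derivWeierstrassP_sq z hz.1)
    (fun n => weierstrassP_ne_of_mem_genericSet hγ hz n) hφ

/-- The operator of order six attached to spectral data on the curve of `Λ`. -/
noncomputable abbrev sixthOrderOp (Λ : PeriodPair) (γ B v c : ℤ → ℂ) : Module.End ℂ (ℤ → ℂ) :=
  sexticOp (fun n => Λ.weierstrassP (γ n)) B v c

theorem LatticeSpectralData.sexticOp_eq (hγ : ∀ n, 2 * γ n ∉ Λ.lattice)
    (h : LatticeSpectralData Λ γ B v c) {z : ℂ} (hz : z ∈ genericSet Λ γ) {φ : ℤ → ℂ}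
    (hφ : IsBakerAkhiezer (fun n => Λ.weierstrassP (γ n)) B v c
      (Λ.weierstrassP z) (Λ.derivWeierstrassP z) φ) :
    sixthOrderOp Λ γ B v c φ = Λ.derivWeierstrassP z • φ :=
  (sexticOp_eq_iff (LatticeSpectralData.quarticOp_eq hγ h hz hφ)).2 hφ

theorem isLocalOp_fourthOrderOp : IsLocalOp (fourthOrderOp Λ γ v c) :=
  isLocalOp_quarticOp _ _ _

/-- Both operators act on every Baker-Akhiezer function as scalars, so the commutator annihilates
all of them and is zero. -/
theorem LatticeSpectralData.commute (hγ : ∀ n, 2 * γ n ∉ Λ.lattice)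
    (h : LatticeSpectralData Λ γ B v c) :
    Commute (fourthOrderOp Λ γ v c) (sixthOrderOp Λ γ B v c) := by
  have hL := isLocalOp_fourthOrderOp (Λ := Λ) (γ := γ) (v := v) (c := c)
  have hA := isLocalOp_sexticOp (fun n => Λ.weierstrassP (γ n)) B v c
  refine sub_eq_zero.1 (((hL.mul hA).sub (hA.mul hL)).eq_zero_of_isBakerAkhiezer (v := v) (B := B)
    hγ h.c_ne fun z hz φ hφ => ?_)
  have h1 := LatticeSpectralData.quarticOp_eq hγ h hz hφ
  have h2 := LatticeSpectralData.sexticOp_eq hγ h hz hφ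
  simp only [sixthOrderOp] at h2
  simp only [LinearMap.sub_apply, Module.End.mul_apply, h1, h2, map_smul]
  module

theorem LatticeSpectralData.sq_eq (hγ : ∀ n, 2 * γ n ∉ Λ.lattice)
    (h : LatticeSpectralData Λ γ B v c) :
    sixthOrderOp Λ γ B v c ^ 2 = 4 * fourthOrderOp Λ γ v c ^ 3 - Λ.g₂ • fourthOrderOp Λ γ v c
      - Λ.g₃ • (1 : Module.End ℂ (ℤ → ℂ)) := by
  have hL := isLocalOp_fourthOrderOp (Λ := Λ) (γ := γ) (v := v) (c := c)
  have hA := isLocalOp_sexticOp (fun n => Λ.weierstrassP (γ n)) B v c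
  have h4 : (4 : Module.End ℂ (ℤ → ℂ)) = (4 : ℂ) • 1 := by
    refine LinearMap.ext fun φ => ?_
    rw [Module.End.ofNat_apply, LinearMap.smul_apply, Module.End.one_apply]
    module
  rw [h4, smul_one_mul]
  refine sub_eq_zero.1 (IsLocalOp.eq_zero_of_isBakerAkhiezer (v := v) (B := B) hγ h.c_ne
    ((hA.pow 2).sub ((((hL.pow 3).smul 4).sub (hL.smul _)).sub (IsLocalOp.one.smul _)))
    fun z hz φ hφ => ?_)
  have h1 := LatticeSpectralData.quarticOp_eq hγ h hz hφ
  have h2 := LatticeSpectralData.sexticOp_eq hγ h hz hφ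
  have h3 := Λ.derivWeierstrassP_sq z hz.1
  simp only [sixthOrderOp] at h2
  simp only [LinearMap.sub_apply, pow_succ, pow_zero, one_mul, Module.End.mul_apply,
    LinearMap.smul_apply, Module.End.one_apply, h1, h2, map_smul]
  match_scalars
  linear_combination h3

theorem LatticeSpectralData.finrank_eq (hγ : ∀ n, 2 * γ n ∉ Λ.lattice)
    (h : LatticeSpectralData Λ γ B v c) {z : ℂ} (hz : z ∉ Λ.lattice) :
    Module.finrank ℂ (commonEigenspace (fourthOrderOp Λ γ v c) (sixthOrderOp Λ γ B v c)
      (Λ.weierstrassP z) (Λ.derivWeierstrassP z)) = 2 := by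
  have hpq := Λ.derivWeierstrassP_sq z hz
  by_cases hk : ∃ k, Λ.weierstrassP z = Λ.weierstrassP (γ k)
  · obtain ⟨k, hk⟩ := hk
    exact SpectralData.finrank_tyurin h hpq hk (LatticeSpectralData.commute hγ h)
      (LatticeSpectralData.sq_eq hγ h)
  · push Not at hk
    exact SpectralData.finrank_generic h hpq hk

/-- The Baker-Akhiezer functions are the solutions of the second order recurrence. -/
theorem transfer_iff_isBakerAkhiezer (hγ : ∀ n, 2 * γ n ∉ Λ.lattice)
    (hrow : ∀ n z, X n z 0 = ![0, 1])
    (hform : ∀ n z, z ∉ Λ.lattice → z - γ n ∉ Λ.lattice → z + γ n ∉ Λ.lattice →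
        X n z 1 0 = -c (n + 1) + c (n + 1) *
          (Λ.weierstrassP (γ (n + 1)) - Λ.weierstrassP (γ n)) * Λ.invP (γ n) z ∧
        X n z 1 1 = -v (n + 1) + B n * Λ.invP (γ n) z - 1 / 2 * Λ.logDerivP (γ n) z)
    {z : ℂ} (hz : z ∈ genericSet Λ γ) (φ : ℤ → ℂ) :
    (∀ n, ![φ (n + 1), φ (n + 2)] = Matrix.mulVec (X n z) ![φ n, φ (n + 1)]) ↔
      IsBakerAkhiezer (fun n => Λ.weierstrassP (γ n)) B v c
        (Λ.weierstrassP z) (Λ.derivWeierstrassP z) φ := by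
  rw [isBakerAkhiezer_iff fun n => weierstrassP_ne_of_mem_genericSet hγ hz n]
  refine forall_congr' fun n => ?_
  have hne := sub_ne_zero.2 (weierstrassP_ne_of_mem_genericSet hγ hz n)
  obtain ⟨h1, h2⟩ := hform n z hz.1 (hz.2 n).1 (hz.2 n).2
  have hm : Matrix.mulVec (X n z) ![φ n, φ (n + 1)] =
      ![φ (n + 1), X n z 1 0 * φ n + X n z 1 1 * φ (n + 1)] := by
    funext i
    fin_cases i
    · simp [Matrix.mulVec, hrow]
    · simp [Matrix.mulVec, dotProduct, Fin.sum_univ_two]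
  have hval : X n z 1 0 * φ n + X n z 1 1 * φ (n + 1) =
      -c (n + 1) * (Λ.weierstrassP z - Λ.weierstrassP (γ (n + 1))) /
        (Λ.weierstrassP z - Λ.weierstrassP (γ n)) * φ n +
      (-(Λ.derivWeierstrassP z / 2 - B n) / (Λ.weierstrassP z - Λ.weierstrassP (γ n)) - v (n + 1)) *
        φ (n + 1) := by
    rw [h1, h2, PeriodPair.invP, PeriodPair.logDerivP]
    field
  rw [hm, hval]
  simp

theorem correspondsTo_iff {f : ℂ → ℂ} {D : Module.End ℂ (ℤ → ℂ)}
    (hγ : ∀ n, 2 * γ n ∉ Λ.lattice) (hrow : ∀ n z, X n z 0 = ![0, 1])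
    (hform : ∀ n z, z ∉ Λ.lattice → z - γ n ∉ Λ.lattice → z + γ n ∉ Λ.lattice →
        X n z 1 0 = -c (n + 1) + c (n + 1) *
          (Λ.weierstrassP (γ (n + 1)) - Λ.weierstrassP (γ n)) * Λ.invP (γ n) z ∧
        X n z 1 1 = -v (n + 1) + B n * Λ.invP (γ n) z - 1 / 2 * Λ.logDerivP (γ n) z) :
    CorrespondsTo Λ ![γ, -γ] X f D ↔
      ∀ z ∈ genericSet Λ γ, ∀ φ, IsBakerAkhiezer (fun n => Λ.weierstrassP (γ n)) B v c
        (Λ.weierstrassP z) (Λ.derivWeierstrassP z) φ → D φ = f z • φ := by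
  have hgen : ∀ z, (z ∉ Λ.lattice ∧ ∀ s n, z - (![γ, -γ] : Fin 2 → ℤ → ℂ) s n ∉ Λ.lattice) ↔
      z ∈ genericSet Λ γ := fun z => by
    rw [forall_comm]
    simp only [sub_tyurin_notMem_iff, genericSet, Set.mem_ofPred_eq]
  constructor
  · intro h z hz φ hφ
    obtain ⟨h1, h2⟩ := (hgen z).2 hz
    exact h z h1 h2 φ ((transfer_iff_isBakerAkhiezer hγ hrow hform hz φ).2 hφ)
  · intro h z h1 h2 φ hφ
    have hz := (hgen z).1 ⟨h1, h2⟩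
    exact h z hz φ ((transfer_iff_isBakerAkhiezer hγ hrow hform hz φ).1 hφ)

/-- Spectral data realising an arbitrary sequence `s`. -/
theorem exists_latticeSpectralData (hγ : ∀ n, 2 * γ n ∉ Λ.lattice)
    (hadd : ∀ n, γ (n + 1) + γ n ∉ Λ.lattice) (hsub : ∀ n, γ (n + 1) - γ n ∉ Λ.lattice)
    (s : ℤ → ℂ) (hs : ∀ n, s n ^ 2 ≠ 1) :
    ∃ v c : ℤ → ℂ,
      LatticeSpectralData Λ γ (fun n => -s n * Λ.derivWeierstrassP (γ n) / 2) v c := by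
  have hq := fun n => Λ.derivWeierstrassP_ne_zero (hγ n)
  have hd := weierstrassP_sub_pred_ne_zero hγ hadd hsub
  -- These solve `v_eq` at `n` and `c_eq` at `n - 1` for `B = -s Q / 2`. The hypothesis `s² ≠ 1` is
  -- what makes `c` nonzero.
  refine ⟨fun n => (-s n * Λ.derivWeierstrassP (γ n) / 2
      + -s (n - 1) * Λ.derivWeierstrassP (γ (n - 1)) / 2) /
      (Λ.weierstrassP (γ n) - Λ.weierstrassP (γ (n - 1))),
    fun n => (s (n - 1) ^ 2 - 1) * Λ.derivWeierstrassP (γ (n - 1)) ^ 2 / 4 /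
      ((Λ.weierstrassP (γ n) - Λ.weierstrassP (γ (n - 1))) *
        (Λ.weierstrassP (γ (n - 1)) - Λ.weierstrassP (γ (n - 1 - 1)))),
    weierstrassP_succ_ne hγ hadd hsub, hq, fun n => ?_,
    fun n => Λ.derivWeierstrassP_sq _ (Λ.notMem_lattice_of_two_mul (hγ n)),
    fun n => div_mul_cancel₀ _ (hd n), fun n => ?_⟩
  · have h1 := sub_ne_zero.2 (hs (n - 1))
    exact div_ne_zero (div_ne_zero (mul_ne_zero h1 (pow_ne_zero 2 (hq _))) (by norm_num))
      (mul_ne_zero (hd n) (hd _))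
  · have h1 := hd (n + 1)
    have h2 := hd n
    simp only [add_sub_cancel_right] at h1 ⊢
    field

end

/-! ### The main theorem. -/

theorem mainTheorem10 (Λ : PeriodPair) (γ : ℤ → ℂ)
    (hγ : ∀ n, 2 * γ n ∉ Λ.lattice)
    (hadd : ∀ n, γ (n + 1) + γ n ∉ Λ.lattice)
    (hsub : ∀ n, γ (n + 1) - γ n ∉ Λ.lattice) :
    (∀ s : ℤ → ℂ, (∀ n, s n ^ 2 ≠ 1) →
      ∃ (a : Fin 2 → ℤ → ℂ) (c v : ℤ → ℂ) (X : ℤ → ℂ → Matrix (Fin 2) (Fin 2) ℂ),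
        IsTyurinDynamics Λ ![γ, -γ] a c v X ∧ (∀ n, a 0 n ≠ a 1 n) ∧ sParam a = s) ∧
    (∀ (a : Fin 2 → ℤ → ℂ) (c v : ℤ → ℂ) (X : ℤ → ℂ → Matrix (Fin 2) (Fin 2) ℂ),
      IsTyurinDynamics Λ ![γ, -γ] a c v X →
        (∀ n, a 0 n ≠ a 1 n) ∧
        (∀ n, sParam a n ^ 2 ≠ 1) ∧
        (∀ n, 4 * c (n + 1) = (1 - sParam a n ^ 2) * ellF Λ (γ (n + 1)) (γ n) *
          ellF Λ (γ (n - 1)) (γ n)) ∧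
        (∀ n, 2 * v (n + 1) = sParam a n * ellF Λ (γ (n + 1)) (γ n) -
          sParam a (n + 1) * ellF Λ (γ n) (γ (n + 1))) ∧
        HasExactBand 2 2 (fourthOrderOp Λ γ v c) ∧
        (∀ D : Module.End ℂ (ℤ → ℂ), IsDifferenceOp D →
          (CorrespondsTo Λ ![γ, -γ] X Λ.weierstrassP D ↔ D = fourthOrderOp Λ γ v c)) ∧
        ∃ A : Module.End ℂ (ℤ → ℂ),
          HasExactBand 3 3 A ∧
          CorrespondsTo Λ ![γ, -γ] X Λ.derivWeierstrassP A ∧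
          Commute (fourthOrderOp Λ γ v c) A ∧
          A ^ 2 = 4 * fourthOrderOp Λ γ v c ^ 3 - Λ.g₂ • fourthOrderOp Λ γ v c
            - Λ.g₃ • (1 : Module.End ℂ (ℤ → ℂ)) ∧
          ∀ z, z ∉ Λ.lattice → Module.finrank ℂ (commonEigenspace (fourthOrderOp Λ γ v c) A
            (Λ.weierstrassP z) (Λ.derivWeierstrassP z)) = 2)
 := by
  have hq := fun n => Λ.derivWeierstrassP_ne_zero (hγ n)
  have hd := weierstrassP_sub_pred_ne_zero hγ hadd hsub
  constructor
  · intro s hs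
    obtain ⟨v, c, h⟩ := exists_latticeSpectralData hγ hadd hsub s hs
    -- The vectors `a` are `(B ± Q/2) / (P_n - P_{n-1})` with `B = -s Q / 2`: their difference is
    -- proportional to `Q` and their sum to `-s Q`, with the same factor.
    refine ⟨![fun n => (-s n * Λ.derivWeierstrassP (γ n) / 2 + Λ.derivWeierstrassP (γ n) / 2) /
        (Λ.weierstrassP (γ n) - Λ.weierstrassP (γ (n - 1))),
      fun n => (-s n * Λ.derivWeierstrassP (γ n) / 2 - Λ.derivWeierstrassP (γ n) / 2) /
        (Λ.weierstrassP (γ n) - Λ.weierstrassP (γ (n - 1)))], c, v, _,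
      SpectralData.isTyurinDynamics hγ h (fun n => div_mul_cancel₀ _ (hd n))
        (fun n => div_mul_cancel₀ _ (hd n)), fun n h0 => ?_, funext fun n => ?_⟩
    · simp only [Matrix.cons_val_zero, Matrix.cons_val_one, div_left_inj' (hd n)] at h0
      exact hq n (by linear_combination h0)
    · have h1 := hq n
      have h2 := hd n
      simp only [sParam, Matrix.cons_val_zero, Matrix.cons_val_one]
      field
  · intro a c v X hX
    obtain ⟨B, h, ha0, ha1, hform⟩ := hX.exists_spectralData hγ hadd hsub
    have hmem := fun n => Λ.notMem_lattice_of_two_mul (hγ n)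
    have ha : ∀ n, (a 0 n - a 1 n) * (Λ.weierstrassP (γ n) - Λ.weierstrassP (γ (n - 1))) =
        Λ.derivWeierstrassP (γ n) := fun n => by linear_combination ha0 n - ha1 n
    have hne : ∀ n, a 0 n - a 1 n ≠ 0 := fun n h0 => hq n (by rw [← ha n, h0, zero_mul])
    have hs : ∀ n, sParam a n * Λ.derivWeierstrassP (γ n) = -2 * B n := by
      intro n
      rw [← ha n, sParam]
      have := hne n
      field_simp
      linear_combination -ha0 n - ha1 n
    have hc : ∀ n, 4 * (c (n + 1) * (Λ.weierstrassP (γ (n + 1)) - Λ.weierstrassP (γ n)) *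
        (Λ.weierstrassP (γ n) - Λ.weierstrassP (γ (n - 1)))) =
        (sParam a n ^ 2 - 1) * Λ.derivWeierstrassP (γ n) ^ 2 := fun n => by
      rw [h.c_eq n]
      linear_combination (2 * B n - sParam a n * Λ.derivWeierstrassP (γ n)) * hs n
    have hsucc := fun n => sub_ne_zero.2 (weierstrassP_succ_ne hγ hadd hsub n)
    have hF1 : ∀ n, ellF Λ (γ (n + 1)) (γ n) = Λ.derivWeierstrassP (γ n) /
        (Λ.weierstrassP (γ n) - Λ.weierstrassP (γ (n + 1))) := fun n =>
      Λ.ellF_eq (hγ n) (hmem _) (hadd n) (hsub n)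
    have hF2 : ∀ n, ellF Λ (γ n) (γ (n + 1)) = Λ.derivWeierstrassP (γ (n + 1)) /
        (Λ.weierstrassP (γ (n + 1)) - Λ.weierstrassP (γ n)) := fun n =>
      Λ.ellF_eq (hγ _) (hmem _) (by rw [add_comm]; exact hadd n)
        (by rw [← neg_sub]; exact Λ.neg_notMem_lattice (hsub n))
    refine ⟨fun n => sub_ne_zero.1 (hne n), fun n hn => ?_, fun n => ?_, fun n => ?_,
      hasExactBand_quarticOp _ _ h.c_ne, fun D hD => ?_, sixthOrderOp Λ γ B v c,
      hasExactBand_sexticOp _ _ _ h.c_ne, ?_, LatticeSpectralData.commute hγ h,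
      LatticeSpectralData.sq_eq hγ h, fun z hz => LatticeSpectralData.finrank_eq hγ h hz⟩
    -- If `s_n² = 1`, the relation `hc` would force `c (n + 1) = 0`.
    · have h1 := hc n
      rw [hn, sub_self, zero_mul] at h1
      exact mul_ne_zero (by norm_num : (4 : ℂ) ≠ 0)
        (mul_ne_zero (mul_ne_zero (h.c_ne _) (hsucc n)) (hd n)) h1
    · have h1 := hF2 (n - 1)
      rw [sub_add_cancel] at h1
      rw [hF1, h1]
      have h2 := hc n
      have h3 := hsucc n
      have h4 := hd n
      rw [← neg_sub (Λ.weierstrassP (γ (n + 1))), div_neg]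
      field_simp
      linear_combination h2
    · rw [hF1, hF2]
      have h1 := h.v_eq (n + 1)
      have h2 := hs n
      have h3 := hs (n + 1)
      have h4 := hsucc n
      simp only [add_sub_cancel_right] at h1
      rw [← neg_sub (Λ.weierstrassP (γ (n + 1))), div_neg]
      field_simp
      linear_combination 2 * h1 + h2 + h3
    · rw [correspondsTo_iff hγ hX.first_row hform]
      constructor
      · intro h1
        refine sub_eq_zero.1 (((IsLocalOp.of_isDifferenceOp hD).sub
          isLocalOp_fourthOrderOp).eq_zero_of_isBakerAkhiezer (v := v) (B := B) hγ h.c_ne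
          fun z hz φ hφ => ?_)
        rw [LinearMap.sub_apply, h1 z hz φ hφ, LatticeSpectralData.quarticOp_eq hγ h hz hφ, sub_self]
      · rintro rfl z hz φ hφ
        exact LatticeSpectralData.quarticOp_eq hγ h hz hφ
    · rw [correspondsTo_iff hγ hX.first_row hform]
      exact fun z hz φ hφ => LatticeSpectralData.sexticOp_eq hγ h hz hφ
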